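/- **Setting.** Let $(X_1,X_2)$ be a pair of random variables with an arbitrary joint law $P$ on a product of measurable spaces $\mathbb X_1\times\mathbb X_2$, let the reproduction alphabets $\widehat{\mathbb X}_1,\widehat{\mathbb X}_2$ be nonempty standard Borel spaces, let $D_i:\mathbb X_i\times\widehat{\mathbb X}_i\to[0,\infty]$ be measurable distortion functions and let $\Delta_1,\Delta_2\in[0,\infty)$. An *auxiliary variable* $W$ takes values in an arbitrary measurable space and is jointly distributed with $(X_1,X_2)$ so that the $(X_1,X_2)$-marginal is $P$. All information quantities take values in $[0,\infty]$, and an infimum over the empty set is $\infty$. Put $$R_{X_1,X_2}(\Delta_1,\Delta_2)=\inf_{P_{\widehat X_1,\widehat X_2|X_1,X_2}:\ \mathbf E D_i(X_i,\widehat X_i)\le\Delta_i,\ i=1,2} I(X_1,X_2;\widehat X_1,\widehat X_2),\qquad R_{X_i|W}(\Delta_i)=\inf_{P_{\widehat X_i|X_i,W}:\ \mathbf E D_i(X_i,\widehat X_i)\le\Delta_i} I(X_i;\widehat X_i|W);$$ channels attaining these infima are called *test channels*. For each $P_{X_1,X_2,W}$ let $$\mathcal R^{P_{X_1,X_2,W}}(\Delta_1,\Delta_2)=\{(R_0,R_1,R_2)\in[0,\infty)^3: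 R_0\ge I(X_1,X_2;W),\ R_1\ge R_{X_1|W}(\Delta_1),\ R_2\ge R_{X_2|W}(\Delta_2)\}.$$ The Gray–Wyner region $\mathcal R(\Delta_1,\Delta_2)$ is the closure of the union of these sets over all auxiliary variables $W$. The Pangloss plane is the set of $(R_0,R_1,R_2)\in\mathcal R(\Delta_1,\Delta_2)$ with $R_0+R_1+R_2=R_{X_1,X_2}(\Delta_1,\Delta_2)$. For given $P_{X_1,X_2,W}$ let $\mathcal D_{X_1,X_2|W}\subseteq[0,\infty)^2$ be the set of pairs $(\Delta_1,\Delta_2)$ for which there is a joint law $P_{W,X_1,X_2,\widehat X_1,\widehat X_2}$ with the given marginal $P_{X_1,X_2,W}$ such that $$P_{\widehat X_1,\widehat X_2|W}=P_{\widehat X_1|W}P_{\widehat X_2|W},\qquad P_{X_1,X_2|\widehat X_1,\widehat X_2,W}=P_{X_1,X_2|\widehat X_1,\widehat X_2},$$ and such that the marginals $P_{X_1,X_2,\widehat X_1,\widehat X_2}$ and $P_{X_i,\widehat X_i,W}$, $i=1,2$, are generated by test channels of $R_{X_1,X_2}(\Delta_1,\Delta_2)$ and $R_{X_i|W}(\Delta_i)$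 respectively. **Theorem.** The rate triples on the Pangloss plane are characterized by $$I(X_1,X_2;W)+R_{X_1|W}(\Delta_1)+R_{X_2|W}(\Delta_2)=R_{X_1,X_2}(\Delta_1,\Delta_2)\qquad(*)$$ in the following sense. (a) For every auxiliary $W$, a triple $(R_0,R_1,R_2)\in\mathcal R^{P_{X_1,X_2,W}}(\Delta_1,\Delta_2)$ lies on the Pangloss plane if and only if $R_0=I(X_1,X_2;W)$, $R_1=R_{X_1|W}(\Delta_1)$, $R_2=R_{X_2|W}(\Delta_2)$ and $(*)$ holds. (b) A triple $(R_0,R_1,R_2)\in[0,\infty)^3$ lies on the Pangloss plane if and only if $R_0+R_1+R_2=R_{X_1,X_2}(\Delta_1,\Delta_2)$ and there are auxiliary variables $W_n$, $n\in\mathbb N$, with $I(X_1,X_2;W_n)\to R_0$, $R_{X_1|W_n}(\Delta_1)\to R_1$ and $R_{X_2|W_n}(\Delta_2)\to R_2$. (c) For every auxiliary $W$, if $(\Delta_1,\Delta_2)\in\mathcal D_{X_1,X_2|W}$, then $(*)$ holds, and if moreover $R_{X_1,X_2}(\Delta_1,\Delta_2)<\infty$, then the triple $(I(X_1,X_2;W),R_{X_1|W}(\Delta_1),R_{X_2|W}(\Delta_2))$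 lies on the Pangloss plane. (d) Conversely, for every auxiliary $W$, if $R_{X_1,X_2}(\Delta_1,\Delta_2)<\infty$, $(*)$ holds, and $R_{X_1|W}(\Delta_1)$ and $R_{X_2|W}(\Delta_2)$ have test channels, then $(\Delta_1,\Delta_2)\in\mathcal D_{X_1,X_2|W}$. -/

import Mathlib

open MeasureTheory ProbabilityTheory InformationTheory Filter Topology
open scoped ENNReal NNReal

universe w

noncomputable section

namespace GrayWyner

universe u₁ u₂ v₁ v₂

/-! Information measures, in nats. They take values in `[0, ∞]`. -/

/-- Mutual information `I(A; B)` of the joint law `μ` of `(A, B)`: the Kullback-Leibler divergence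
of the joint law from the product of its marginals. -/
def mutualInfo {A B : Type*} [MeasurableSpace A] [MeasurableSpace B] (μ : Measure (A × B)) :
    ℝ≥0∞ :=
  klDiv μ (μ.fst.prod μ.snd)

/-- Conditional mutual information `I(A; B | C)` of the joint law `μ` of `((A, C), B)`: the
Kullback-Leibler divergence of the joint law from `P_C P_{A|C} P_{B|C} = P_{A,C} P_{B|C}`. -/
def condMutualInfo {A B C : Type*} [MeasurableSpace A] [MeasurableSpace B] [MeasurableSpace C]
    [StandardBorelSpace B] [Nonempty B] (μ : Measure ((A × C) × B)) [IsFiniteMeasure μ] : ℝ≥0∞ :=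
  klDiv μ (μ.fst ⊗ₘ
    Kernel.prodMkLeft A (condDistrib (fun z : (A × C) × B => z.2) (fun z => z.1.2) μ))

/-! Conditional independence of random variables on a probability space. -/

/-- `P_{f,g|h} = P_{f|h} P_{g|h}` almost surely. -/
def CondIndepGiven {Ω A B C : Type*} [MeasurableSpace Ω] [MeasurableSpace A] [MeasurableSpace B]
    [mC : MeasurableSpace C] (Q : Measure Ω) (f : Ω → A) (g : Ω → B) (h : Ω → C) : Prop :=
  ∀ (s : Set A) (t : Set B), MeasurableSet s → MeasurableSet t →
    Q⟦f ⁻¹' s ∩ g ⁻¹' t | mC.comap h⟧ =ᵐ[Q]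
      fun ω => (Q⟦f ⁻¹' s | mC.comap h⟧) ω * (Q⟦g ⁻¹' t | mC.comap h⟧) ω

/-- `P_{f|g,h} = P_{f|g}` almost surely. -/
def CondLawEq {Ω A B C : Type*} [MeasurableSpace Ω] [MeasurableSpace A] [mB : MeasurableSpace B]
    [mC : MeasurableSpace C] (Q : Measure Ω) (f : Ω → A) (g : Ω → B) (h : Ω → C) : Prop :=
  ∀ s : Set A, MeasurableSet s →
    Q⟦f ⁻¹' s | (inferInstance : MeasurableSpace (B × C)).comap (fun ω => (g ω, h ω))⟧ =ᵐ[Q]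
      Q⟦f ⁻¹' s | mB.comap g⟧

/-! Rate distortion functions. -/

section RDF

variable {X₁ : Type u₁} {X₂ : Type u₂} {Y₁ : Type v₁} {Y₂ : Type v₂}
  [MeasurableSpace X₁] [MeasurableSpace X₂] [MeasurableSpace Y₁] [MeasurableSpace Y₂]

/-- The channel `κ` from `(X₁, X₂)` to `(Y₁, Y₂)` meets both distortion constraints. -/
def JointFeasible (P : Measure (X₁ × X₂)) (D₁ : X₁ → Y₁ → ℝ≥0∞) (D₂ : X₂ → Y₂ → ℝ≥0∞)
    (Δ₁ Δ₂ : ℝ≥0) (κ : Kernel (X₁ × X₂) (Y₁ × Y₂)) : Prop :=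
  ∫⁻ z, D₁ z.1.1 z.2.1 ∂(P ⊗ₘ κ) ≤ Δ₁ ∧ ∫⁻ z, D₂ z.1.2 z.2.2 ∂(P ⊗ₘ κ) ≤ Δ₂

/-- The joint rate distortion function `R_{X₁,X₂}(Δ₁, Δ₂)` of a source with law `P`. -/
def jointRDF (P : Measure (X₁ × X₂)) (D₁ : X₁ → Y₁ → ℝ≥0∞) (D₂ : X₂ → Y₂ → ℝ≥0∞)
    (Δ₁ Δ₂ : ℝ≥0) : ℝ≥0∞ :=
  ⨅ (κ : Kernel (X₁ × X₂) (Y₁ × Y₂)) (_ : IsMarkovKernel κ)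
    (_ : JointFeasible P D₁ D₂ Δ₁ Δ₂ κ), mutualInfo (P ⊗ₘ κ)

/-- `κ` is a test channel of `R_{X₁,X₂}(Δ₁, Δ₂)`: it attains the infimum. -/
def IsJointTestChannel (P : Measure (X₁ × X₂)) (D₁ : X₁ → Y₁ → ℝ≥0∞) (D₂ : X₂ → Y₂ → ℝ≥0∞)
    (Δ₁ Δ₂ : ℝ≥0) (κ : Kernel (X₁ × X₂) (Y₁ × Y₂)) : Prop :=
  IsMarkovKernel κ ∧ JointFeasible P D₁ D₂ Δ₁ Δ₂ κ ∧
    mutualInfo (P ⊗ₘ κ) = jointRDF P D₁ D₂ Δ₁ Δ₂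

end RDF

section CondRDF

variable {A B C : Type*} [MeasurableSpace A] [MeasurableSpace B] [MeasurableSpace C]

/-- The channel `κ` from `(A, C)` to `B` meets the average distortion constraint. -/
def CondFeasible (ν : Measure (A × C)) (D : A → B → ℝ≥0∞) (Δ : ℝ≥0) (κ : Kernel (A × C) B) :
    Prop :=
  ∫⁻ z, D z.1.1 z.2 ∂(ν ⊗ₘ κ) ≤ Δ

variable [StandardBorelSpace B] [Nonempty B]

/-- The conditional rate distortion function `R_{A|C}(Δ)` of `A` given `C`, where `(A, C)` has
law `ν` and `C` is available to both encoder and decoder. -/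
def condRDF (ν : Measure (A × C)) [IsFiniteMeasure ν] (D : A → B → ℝ≥0∞) (Δ : ℝ≥0) : ℝ≥0∞ :=
  ⨅ (κ : Kernel (A × C) B) (_ : IsMarkovKernel κ) (_ : CondFeasible ν D Δ κ),
    condMutualInfo (ν ⊗ₘ κ)

/-- `κ` is a test channel of `R_{A|C}(Δ)`: it attains the infimum. -/
def IsCondTestChannel (ν : Measure (A × C)) [IsFiniteMeasure ν] (D : A → B → ℝ≥0∞) (Δ : ℝ≥0)
    (κ : Kernel (A × C) B) : Prop :=
  ∃ _ : IsMarkovKernel κ, CondFeasible ν D Δ κ ∧ condMutualInfo (ν ⊗ₘ κ) = condRDF ν D Δ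

end CondRDF

/-! The Gray-Wyner region. -/

section Region

variable {X₁ : Type u₁} {X₂ : Type u₂} {Y₁ : Type v₁} {Y₂ : Type v₂} {W : Type w}
  [MeasurableSpace X₁] [MeasurableSpace X₂] [MeasurableSpace Y₁] [MeasurableSpace Y₂]
  [MeasurableSpace W]

/-- The law of `(X₁, W)` when `((X₁, X₂), W)` has law `ν`. -/
abbrev law₁ (ν : Measure ((X₁ × X₂) × W)) : Measure (X₁ × W) := ν.map fun z => (z.1.1, z.2)

/-- The law of `(X₂, W)` when `((X₁, X₂), W)` has law `ν`. -/
abbrev law₂ (ν : Measure ((X₁ × X₂) × W)) : Measure (X₂ × W) := ν.map fun z => (z.1.2, z.2)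

variable [StandardBorelSpace Y₁] [Nonempty Y₁] [StandardBorelSpace Y₂] [Nonempty Y₂]

/-- The triple `(I(X₁,X₂;W), R_{X₁|W}(Δ₁), R_{X₂|W}(Δ₂))` for the law `ν` of `((X₁, X₂), W)`. -/
def cornerPoint (ν : Measure ((X₁ × X₂) × W)) [IsFiniteMeasure ν]
    (D₁ : X₁ → Y₁ → ℝ≥0∞) (D₂ : X₂ → Y₂ → ℝ≥0∞) (Δ₁ Δ₂ : ℝ≥0) : Fin 3 → ℝ≥0∞ :=
  ![mutualInfo ν, condRDF (law₁ ν) D₁ Δ₁, condRDF (law₂ ν) D₂ Δ₂]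

/-- The set of rate triples `(R₀, R₁, R₂)` associated with one auxiliary variable `W`:
`R₀ ≥ I(X₁,X₂;W)`, `R₁ ≥ R_{X₁|W}(Δ₁)`, `R₂ ≥ R_{X₂|W}(Δ₂)`, all nonnegative reals. -/
def auxRegion (ν : Measure ((X₁ × X₂) × W)) [IsFiniteMeasure ν]
    (D₁ : X₁ → Y₁ → ℝ≥0∞) (D₂ : X₂ → Y₂ → ℝ≥0∞) (Δ₁ Δ₂ : ℝ≥0) : Set (Fin 3 → ℝ) :=
  {R | ∀ i, 0 ≤ R i ∧ cornerPoint ν D₁ D₂ Δ₁ Δ₂ i ≤ ENNReal.ofReal (R i)}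

/-- The Gray-Wyner region: the closure of the union of the sets above over all auxiliary
variables `W` (in an arbitrary measurable space) and all joint laws of `((X₁, X₂), W)` with
`(X₁, X₂)`-marginal `P`. -/
def region.{w', u₁', u₂', v₁', v₂'} {X₁ : Type u₁'} {X₂ : Type u₂'} {Y₁ : Type v₁'}
    {Y₂ : Type v₂'} [MeasurableSpace X₁] [MeasurableSpace X₂] [MeasurableSpace Y₁]
    [MeasurableSpace Y₂] [StandardBorelSpace Y₁] [Nonempty Y₁] [StandardBorelSpace Y₂]
    [Nonempty Y₂] (P : Measure (X₁ × X₂)) (D₁ : X₁ → Y₁ → ℝ≥0∞) (D₂ : X₂ → Y₂ → ℝ≥0∞)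
    (Δ₁ Δ₂ : ℝ≥0) : Set (Fin 3 → ℝ) :=
  closure {R | ∃ (W : Type w') (_ : MeasurableSpace W) (ν : Measure ((X₁ × X₂) × W))
    (_ : IsProbabilityMeasure ν), ν.fst = P ∧ R ∈ auxRegion ν D₁ D₂ Δ₁ Δ₂}

/-- The Pangloss plane: the triples of the Gray-Wyner region with
`R₀ + R₁ + R₂ = R_{X₁,X₂}(Δ₁, Δ₂)`. -/
def panglossPlane.{w', u₁', u₂', v₁', v₂'} {X₁ : Type u₁'} {X₂ : Type u₂'} {Y₁ : Type v₁'}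
    {Y₂ : Type v₂'} [MeasurableSpace X₁] [MeasurableSpace X₂] [MeasurableSpace Y₁]
    [MeasurableSpace Y₂] [StandardBorelSpace Y₁] [Nonempty Y₁] [StandardBorelSpace Y₂]
    [Nonempty Y₂] (P : Measure (X₁ × X₂)) (D₁ : X₁ → Y₁ → ℝ≥0∞) (D₂ : X₂ → Y₂ → ℝ≥0∞)
    (Δ₁ Δ₂ : ℝ≥0) : Set (Fin 3 → ℝ) :=
  {R | R ∈ region.{w', u₁', u₂', v₁', v₂'} P D₁ D₂ Δ₁ Δ₂ ∧
    ENNReal.ofReal (∑ i, R i) = jointRDF P D₁ D₂ Δ₁ Δ₂}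

/-- The distortion region of the law `ν` of `((X₁, X₂), W)`: the pairs `(Δ₁, Δ₂)` for which some
joint law `Q` of `(((X₁, X₂), W), (Y₁, Y₂))` extending `ν` satisfies
`P_{Y₁,Y₂|W} = P_{Y₁|W} P_{Y₂|W}` and `P_{X₁,X₂|Y₁,Y₂,W} = P_{X₁,X₂|Y₁,Y₂}`, while its marginals
on `(X₁, X₂, Y₁, Y₂)` and `(Xᵢ, Yᵢ, W)` are generated by test channels of `R_{X₁,X₂}(Δ₁, Δ₂)` and
`R_{Xᵢ|W}(Δᵢ)`. -/
def distortionRegion (ν : Measure ((X₁ × X₂) × W)) [IsFiniteMeasure ν]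
    (D₁ : X₁ → Y₁ → ℝ≥0∞) (D₂ : X₂ → Y₂ → ℝ≥0∞) : Set (ℝ≥0 × ℝ≥0) :=
  {Δ | ∃ (Q : Measure (((X₁ × X₂) × W) × (Y₁ × Y₂))),
    Q.fst = ν ∧
    CondIndepGiven Q (fun z => z.2.1) (fun z => z.2.2) (fun z => z.1.2) ∧
    CondLawEq Q (fun z => z.1.1) (fun z => z.2) (fun z => z.1.2) ∧
    (∃ κ : Kernel (X₁ × X₂) (Y₁ × Y₂), IsJointTestChannel ν.fst D₁ D₂ Δ.1 Δ.2 κ ∧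
      Q.map (fun z => (z.1.1, z.2)) = ν.fst ⊗ₘ κ) ∧
    (∃ κ₁ : Kernel (X₁ × W) Y₁, IsCondTestChannel (law₁ ν) D₁ Δ.1 κ₁ ∧
      Q.map (fun z => ((z.1.1.1, z.1.2), z.2.1)) = law₁ ν ⊗ₘ κ₁) ∧
    (∃ κ₂ : Kernel (X₂ × W) Y₂, IsCondTestChannel (law₂ ν) D₂ Δ.2 κ₂ ∧
      Q.map (fun z => ((z.1.1.2, z.1.2), z.2.2)) = law₂ ν ⊗ₘ κ₂)}

end Region

end GrayWyner

end

/-! Write X = (X₁, X₂), Y = (Y₁, Y₂). Everything rests on one identity, `mutualInfo_fst_add_klDiv`: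
for a law Q of (X, W, Y) and a kernel η from W to Y, the divergence of Q from P_X P_W η can be split
in two ways, which gives I(X;W) + D(Q ‖ P_{X,W} η) = I(X;Y,W) + D(P_{W,Y} ‖ P_W η). Take η =
P_{Y₁|W} P_{Y₂|W}. If Y₁ and Y₂ are produced from (X₁,W) and (X₂,W) by independently used channels,
the second term on the left is exactly I(X₁;Y₁|W) + I(X₂;Y₂|W) (`exists_coupling`). The right side
is at least I(X;Y), and Y is feasible for the joint problem, so the left side of (*) always
dominates the right side (`jointRDF_le_add`).

Equality with a finite value makes both losses vanish: the last divergence, which is conditional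
independence of Y₁ and Y₂ given W, and I(X;Y,W) − I(X;Y), which is the Markov condition. This gives
(d). For (c), Q is arbitrary and the second term on the left is only at least the sum of the two
conditional informations (`klDiv_add_klDiv_le`), which is the direction needed.

Parts (a) and (b) follow from the inequality alone: three coordinates dominated by those of a
triple, with a sum no smaller than its sum, must equal it, and the same squeeze works along
sequences. The divergence identities hold in [0, ∞], infinite values included; finiteness is needed
only to cancel a term. -/

namespace InformationTheory

/-! ### Divergence: chain rule along a map, and pulled-back kernels. -/

variable {α β : Type*} {mα : MeasurableSpace α} {mβ : MeasurableSpace β}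

lemma klDiv_map_measurableEquiv (μ ν : Measure α) [IsFiniteMeasure μ] [IsFiniteMeasure ν]
    (e : α ≃ᵐ β) : klDiv (μ.map e) (ν.map e) = klDiv μ ν := by
  refine le_antisymm (klDiv_map_le μ ν e.measurable) ?_
  have h := klDiv_map_le (μ.map e) (ν.map e) e.symm.measurable
  rwa [Measure.map_map e.symm.measurable e.measurable,
    Measure.map_map e.symm.measurable e.measurable, e.symm_comp_self, Measure.map_id,
    Measure.map_id] at h

/-- **Chain rule** for the Kullback-Leibler divergence along a measurable map `T`. The measure in
the first term of the sum is the tilt of `ν` whose image by `T` is that of `μ`. -/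
theorem klDiv_eq_add_klDiv_map {μ ν : Measure α} [IsProbabilityMeasure μ]
    [IsProbabilityMeasure ν] (hμν : μ ≪ ν) {T : α → β} (hT : Measurable T) :
    klDiv μ ν = klDiv μ (ν.withDensity fun x => (μ.map T).rnDeriv (ν.map T) (T x)) +
      klDiv (μ.map T) (ν.map T) := by
  have : IsProbabilityMeasure (μ.map T) := Measure.isProbabilityMeasure_map hT.aemeasurable
  have : IsProbabilityMeasure (ν.map T) := Measure.isProbabilityMeasure_map hT.aemeasurable
  have hTac : μ.map T ≪ ν.map T := hμν.map hT
  set g := (μ.map T).rnDeriv (ν.map T) with hg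
  have hgm : Measurable g := Measure.measurable_rnDeriv _ _
  have hgT : Measurable fun x => g (T x) := hgm.comp hT
  set ν' := ν.withDensity fun x => g (T x) with hν'
  have : IsProbabilityMeasure ν' := by
    refine ⟨?_⟩
    rw [hν', withDensity_apply _ MeasurableSet.univ, Measure.restrict_univ,
      ← lintegral_map hgm hT, Measure.lintegral_rnDeriv hTac]
    exact measure_univ
  have hgpos : ∀ᵐ x ∂μ, 0 < g (T x) := ae_of_ae_map hT.aemeasurable (Measure.rnDeriv_pos hTac)
  have hgtop : ∀ᵐ x ∂μ, g (T x) < ∞ :=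
    ae_of_ae_map hT.aemeasurable (hTac.ae_le (Measure.rnDeriv_lt_top _ _))
  have hac : μ ≪ ν' := by
    intro s hs
    rw [hν', withDensity_apply_eq_zero hgT] at hs
    refine measure_mono_null (t := {x | ¬ 0 < g (T x)} ∪ ({x | g (T x) ≠ 0} ∩ s)) ?_ ?_
    · intro x hx
      by_cases h : g (T x) = 0 <;> simp [h, hx]
    · exact measure_union_null (ae_iff.1 hgpos) (hμν hs)
  -- The density of μ with respect to ν factors as its density with respect to the tilt ν', times g
  -- ∘ T. Positivity and finiteness of both factors, μ-almost everywhere, allow taking logarithms.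
  have hllr : llr μ ν =ᵐ[μ] fun x => llr μ ν' x + llr (μ.map T) (ν.map T) (T x) := by
    filter_upwards [hμν.ae_le (Measure.rnDeriv_mul_rnDeriv (κ := ν) hac),
      hμν.ae_le (Measure.rnDeriv_withDensity ν hgT), hgpos, hgtop, Measure.rnDeriv_pos hac,
      hac.ae_le (Measure.rnDeriv_lt_top μ ν')] with x h1 h2 h3 h4 h5 h6
    rw [llr, ← h1, Pi.mul_apply, h2, ENNReal.toReal_mul,
      Real.log_mul (ENNReal.toReal_pos h5.ne' h6.ne).ne' (ENNReal.toReal_pos h3.ne' h4.ne).ne']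
    rfl
  have hcomp : Integrable (llr (μ.map T) (ν.map T)) (μ.map T) ↔
      Integrable (fun x => llr (μ.map T) (ν.map T) (T x)) μ :=
    integrable_map_measure (measurable_llr _ _).aestronglyMeasurable hT.aemeasurable
  -- When one of the two log-likelihood ratios on the right is not integrable, neither is `llr μ ν`,
  -- so both sides are infinite.
  by_cases h2 : Integrable (llr (μ.map T) (ν.map T)) (μ.map T)
  swap
  · rw [klDiv_of_not_integrable h2, add_top,
      klDiv_of_not_integrable fun h => h2 (integrable_llr_map hμν hT h)]
  by_cases h1 : Integrable (llr μ ν') μ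
  swap
  · rw [klDiv_of_not_integrable h1, top_add, klDiv_of_not_integrable fun h => h1 ?_]
    rw [integrable_congr hllr] at h
    exact (integrable_add_iff_integrable_left' (hcomp.1 h2)).1 h
  have h3 : Integrable (llr μ ν) μ := (integrable_congr hllr).2 (h1.add (hcomp.1 h2))
  rw [klDiv_of_ac_of_integrable hμν h3, klDiv_of_ac_of_integrable hac h1,
    klDiv_of_ac_of_integrable hTac h2,
    ← ENNReal.ofReal_add (integral_llr_add_sub_measure_univ_nonneg hac h1)
      (integral_llr_add_sub_measure_univ_nonneg hTac h2),
    integral_congr_ae hllr, integral_add h1 (hcomp.1 h2),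
    integral_map hT.aemeasurable (measurable_llr _ _).aestronglyMeasurable]
  simp

/-- The Kullback-Leibler divergence of a composition-product from another one with the same first
marginal, for kernels pulled back along a measurable map. -/
lemma klDiv_compProd_comap_eq_lintegral {γ : Type*} {mγ : MeasurableSpace γ}
    [MeasurableSpace.CountablyGenerated γ] (μ : Measure α) [IsFiniteMeasure μ]
    (κ η : Kernel β γ) [IsMarkovKernel κ] [IsMarkovKernel η] {p : α → β} (hp : Measurable p)
    (hac : ∀ᵐ a ∂μ, κ (p a) ≪ η (p a)) :
    klDiv (μ ⊗ₘ κ.comap p hp) (μ ⊗ₘ η.comap p hp) =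
      ∫⁻ a, ∫⁻ b, ENNReal.ofReal (klFun (κ.rnDeriv η (p a) b).toReal) ∂η (p a) ∂μ := by
  have hm : Measurable (Function.uncurry fun a b => κ.rnDeriv η (p a) b) :=
    (Kernel.measurable_rnDeriv κ η).comp (hp.prodMap measurable_id)
  have hs : IsSFiniteKernel ((η.comap p hp).withDensity fun a b => κ.rnDeriv η (p a) b) := by
    have h : (η.comap p hp).withDensity (fun a b => κ.rnDeriv η (p a) b) =
        (η.withDensity (κ.rnDeriv η)).comap p hp := by
      ext a : 1
      rw [Kernel.withDensity_apply _ hm, Kernel.comap_apply, Kernel.comap_apply,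
        Kernel.withDensity_apply _ (Kernel.measurable_rnDeriv κ η)]
    rw [h]
    infer_instance
  have heq : μ ⊗ₘ κ.comap p hp =
      (μ ⊗ₘ η.comap p hp).withDensity fun z => κ.rnDeriv η (p z.1) z.2 := by
    rw [← Measure.compProd_withDensity (f := fun a b => κ.rnDeriv η (p a) b) hm]
    refine Measure.compProd_congr ?_
    filter_upwards [hac] with a ha
    rw [Kernel.withDensity_apply _ hm, Kernel.comap_apply, Kernel.comap_apply,
      ← Kernel.withDensity_apply _ (Kernel.measurable_rnDeriv κ η),
      Kernel.withDensity_rnDeriv_eq ha]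
  have hac' : μ ⊗ₘ κ.comap p hp ≪ μ ⊗ₘ η.comap p hp := by
    rw [heq]; exact withDensity_absolutelyContinuous _ _
  rw [klDiv_eq_lintegral_klFun_of_ac hac']
  have hm' : Measurable fun z : α × γ => κ.rnDeriv η (p z.1) z.2 := hm
  have hk : Measurable fun z : α × γ =>
      ENNReal.ofReal (klFun (κ.rnDeriv η (p z.1) z.2).toReal) := by fun_prop
  calc _ = ∫⁻ z, ENNReal.ofReal (klFun (κ.rnDeriv η (p z.1) z.2).toReal)
        ∂(μ ⊗ₘ η.comap p hp) := by
        refine lintegral_congr_ae ?_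
        conv in (μ ⊗ₘ κ.comap p hp).rnDeriv _ => rw [heq]
        filter_upwards [Measure.rnDeriv_withDensity (μ ⊗ₘ η.comap p hp) hm'] with z hz
        rw [hz]
    _ = _ := Measure.lintegral_compProd hk

/-- The integrand of the divergence depends on the base point only through p, so integrating over μ
or over its image is the same. This reduces divergences over (X₁, X₂, W) to divergences over (Xᵢ,
W). If absolute continuity fails, it fails on both sides. -/
lemma klDiv_compProd_comap {γ : Type*} {mγ : MeasurableSpace γ}
    [MeasurableSpace.CountablyGenerated γ] (μ : Measure α) [IsFiniteMeasure μ]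
    (κ η : Kernel β γ) [IsMarkovKernel κ] [IsMarkovKernel η] {p : α → β} (hp : Measurable p) :
    klDiv (μ ⊗ₘ κ.comap p hp) (μ ⊗ₘ η.comap p hp) = klDiv (μ.map p ⊗ₘ κ) (μ.map p ⊗ₘ η) := by
  have hset : MeasurableSet {b | κ b ≪ η b} := Kernel.measurableSet_absolutelyContinuous κ η
  have hiff : (∀ᵐ a ∂μ, κ (p a) ≪ η (p a)) ↔ ∀ᵐ b ∂μ.map p, κ b ≪ η b :=
    (ae_map_iff hp.aemeasurable hset).symm
  by_cases hac : ∀ᵐ a ∂μ, κ (p a) ≪ η (p a)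
  · have h := klDiv_compProd_comap_eq_lintegral (μ.map p) κ η measurable_id (hiff.1 hac)
    simp only [Kernel.comap_id, id_eq] at h
    rw [klDiv_compProd_comap_eq_lintegral μ κ η hp hac, h, lintegral_map _ hp]
    refine Measurable.lintegral_kernel_prod_right (κ := η)
      (f := fun b c => ENNReal.ofReal (klFun (κ.rnDeriv η b c).toReal)) ?_
    have := Kernel.measurable_rnDeriv κ η
    fun_prop
  · rw [klDiv_of_not_ac, klDiv_of_not_ac]
    · exact fun h => hac (hiff.2 h.kernel_of_compProd)
    · intro h
      have := h.kernel_of_compProd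
      exact hac (by simpa using this)

end InformationTheory


namespace GrayWyner

/-! ### Conditional independence and the Markov condition as identities of joint laws. -/

section CondProb

variable {Ω A B C : Type*} {mΩ : MeasurableSpace Ω} {mA : MeasurableSpace A}
  {mB : MeasurableSpace B} {mC : MeasurableSpace C} {Q : Measure Ω}

/-- The defining integral identity of conditional expectation, for a function k that need not come
from a kernel. With its converse `measure_inter_of_condProb_ae_eq` it translates between conditional
probabilities and joint laws without any regular conditional distribution. -/
lemma condProb_ae_eq_toReal [IsFiniteMeasure Q] {g : Ω → B} (hg : Measurable g) {s : Set Ω}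
    (hs : MeasurableSet s) {k : B → ℝ≥0∞} (hk : Measurable k)
    (h : ∀ D, MeasurableSet D → Q (s ∩ g ⁻¹' D) = ∫⁻ ω in g ⁻¹' D, k (g ω) ∂Q) :
    Q⟦s | mB.comap g⟧ =ᵐ[Q] fun ω => (k (g ω)).toReal := by
  have hfin : ∫⁻ ω, k (g ω) ∂Q ≠ ∞ := by
    have := h Set.univ MeasurableSet.univ
    rw [Set.preimage_univ, Set.inter_univ, Measure.restrict_univ] at this
    rw [← this]
    exact measure_ne_top _ _
  have hint : Integrable (fun ω => (k (g ω)).toReal) Q :=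
    integrable_toReal_of_lintegral_ne_top (hk.comp hg).aemeasurable hfin
  symm
  refine ae_eq_condExp_of_forall_setIntegral_eq hg.comap_le
    ((integrable_const _).indicator hs) (fun _ _ _ => hint.integrableOn) ?_ ?_
  · rintro _ ⟨D, hD, rfl⟩ -
    have hkg : Measurable fun ω => k (g ω) := hk.comp hg
    rw [integral_toReal hkg.aemeasurable.restrict
      (ae_restrict_of_ae (ae_lt_top hkg hfin)), ← h D hD,
      setIntegral_indicator hs, setIntegral_const, smul_eq_mul, mul_one, Set.inter_comm,
      measureReal_def]
  · exact (hk.ennreal_toReal.comp (Measurable.of_comap_le le_rfl)).aestronglyMeasurable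

lemma measure_inter_of_condProb_ae_eq [IsFiniteMeasure Q] {s : Set Ω} (hs : MeasurableSet s)
    {k : Ω → ℝ≥0∞} (hfin : ∀ᵐ ω ∂Q, k ω < ∞) {m : MeasurableSpace Ω} (hm : m ≤ mΩ)
    {D : Set Ω} (hD : MeasurableSet[m] D) (h : Q⟦s | m⟧ =ᵐ[Q] fun ω => (k ω).toReal) : Q (s ∩ D) = ∫⁻ ω in D, k ω ∂Q := by
  have hint : Integrable (fun ω => (k ω).toReal) Q := integrable_condExp.congr h
  have h1 : ∫ ω in D, (k ω).toReal ∂Q = Q.real (s ∩ D) := by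
    have hi : Integrable (s.indicator fun _ => (1 : ℝ)) Q := (integrable_const _).indicator hs
    rw [← integral_congr_ae (ae_restrict_of_ae h), setIntegral_condExp hm hi hD, setIntegral_indicator hs,
      setIntegral_const, smul_eq_mul, mul_one, Set.inter_comm]
  have h2 : ∫⁻ ω in D, k ω ∂Q = ∫⁻ ω in D, ENNReal.ofReal (k ω).toReal ∂Q := by
    refine lintegral_congr_ae (ae_restrict_of_ae ?_)
    filter_upwards [hfin] with ω hω
    rw [ENNReal.ofReal_toReal hω.ne]
  rw [h2, ← ofReal_integral_eq_lintegral_ofReal hint.integrableOn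
    (ae_of_all _ fun _ => ENNReal.toReal_nonneg), h1, ofReal_measureReal]

lemma condProb_ae_eq_of_map_eq_compProd [IsFiniteMeasure Q] {f : Ω → A} {h : Ω → C}
    (hf : Measurable f) (hh : Measurable h) {η : Kernel C A} [IsMarkovKernel η]
    (hη : Q.map (fun ω => (h ω, f ω)) = Q.map h ⊗ₘ η) {s : Set A} (hs : MeasurableSet s) :
    Q⟦f ⁻¹' s | mC.comap h⟧ =ᵐ[Q] fun ω => (η (h ω) s).toReal := by
  refine condProb_ae_eq_toReal hh (hf hs) (Kernel.measurable_coe η hs) fun D hD => ?_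
  have := congrArg (fun μ => μ (D ×ˢ s)) hη
  rw [Measure.map_apply (hh.prodMk hf) (hD.prod hs), Measure.compProd_apply_prod hD hs,
    setLIntegral_map hD (Kernel.measurable_coe η hs) hh] at this
  rw [← this, Set.inter_comm]
  rfl

/-- Both sides say that the conditional probability of a rectangle s × t given h is η₁(s) η₂(t), and
boxes D × s × t determine the joint law. -/
theorem condIndepGiven_iff [IsFiniteMeasure Q] {f : Ω → A} {g : Ω → B} {h : Ω → C}
    (hf : Measurable f) (hg : Measurable g) (hh : Measurable h)
    {η₁ : Kernel C A} {η₂ : Kernel C B} [IsMarkovKernel η₁] [IsMarkovKernel η₂]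
    (hη₁ : Q.map (fun ω => (h ω, f ω)) = Q.map h ⊗ₘ η₁)
    (hη₂ : Q.map (fun ω => (h ω, g ω)) = Q.map h ⊗ₘ η₂) :
    CondIndepGiven Q f g h ↔
      Q.map (fun ω => (h ω, (f ω, g ω))) = Q.map h ⊗ₘ (η₁ ×ₖ η₂) := by
  have hval : ∀ (s : Set A) (t : Set B), MeasurableSet s → MeasurableSet t →
      (fun ω => (Q⟦f ⁻¹' s | mC.comap h⟧) ω * (Q⟦g ⁻¹' t | mC.comap h⟧) ω) =ᵐ[Q]
        fun ω => ((η₁ ×ₖ η₂) (h ω) (s ×ˢ t)).toReal := by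
    intro s t hs ht
    filter_upwards [condProb_ae_eq_of_map_eq_compProd hf hh hη₁ hs,
      condProb_ae_eq_of_map_eq_compProd hg hh hη₂ ht] with ω h1 h2
    rw [h1, h2, Kernel.prod_apply, Measure.prod_prod, ENNReal.toReal_mul]
  constructor
  · intro H
    refine Measure.ext_prod₃ fun {D s t} hD hs ht => ?_
    have hk : Measurable fun c => (η₁ ×ₖ η₂) c (s ×ˢ t) := Kernel.measurable_coe _ (hs.prod ht)
    rw [Measure.map_apply (hh.prodMk (hf.prodMk hg)) (hD.prod (hs.prod ht)),
      Measure.compProd_apply_prod hD (hs.prod ht), setLIntegral_map hD hk hh,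
      ← measure_inter_of_condProb_ae_eq ((hf hs).inter (hg ht))
        (k := fun ω => (η₁ ×ₖ η₂) (h ω) (s ×ˢ t)) (ae_of_all _ fun ω => measure_lt_top _ _)
        hh.comap_le ⟨D, hD, rfl⟩ ((H s t hs ht).trans (hval s t hs ht)), Set.inter_comm]
    rfl
  · intro H s t hs ht
    refine (condProb_ae_eq_of_map_eq_compProd (hf.prodMk hg) hh H (hs.prod ht)).trans ?_
    exact (hval s t hs ht).symm

/-- When `I(f; g)` is finite, `f` is conditionally independent of `h` given `g` iff adjoining `h`
to `g` does not increase the mutual information with `f`. -/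
theorem condLawEq_iff_mutualInfo_eq [IsProbabilityMeasure Q] {f : Ω → A} {g : Ω → B} {h : Ω → C}
    (hf : Measurable f) (hg : Measurable g) (hh : Measurable h)
    (hfin : mutualInfo (Q.map fun ω => (f ω, g ω)) ≠ ∞) :
    CondLawEq Q f g h ↔ mutualInfo (Q.map fun ω => (f ω, (g ω, h ω))) =
      mutualInfo (Q.map fun ω => (f ω, g ω)) := by
  have hgh : Measurable fun ω => (g ω, h ω) := hg.prodMk hh
  have := Measure.isProbabilityMeasure_map (μ := Q) hf.aemeasurable
  have := Measure.isProbabilityMeasure_map (μ := Q) hg.aemeasurable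
  have := Measure.isProbabilityMeasure_map (μ := Q) hgh.aemeasurable
  have := Measure.isProbabilityMeasure_map (μ := Q) (hf.prodMk hg).aemeasurable
  have := Measure.isProbabilityMeasure_map (μ := Q) (hf.prodMk hgh).aemeasurable
  have hI : mutualInfo (Q.map fun ω => (f ω, g ω)) =
      klDiv (Q.map fun ω => (f ω, g ω)) ((Q.map f).prod (Q.map g)) := by
    rw [mutualInfo, Measure.fst_map_prodMk hg, Measure.snd_map_prodMk hf]
  rw [hI] at hfin ⊢
  rw [mutualInfo, Measure.fst_map_prodMk hgh, Measure.snd_map_prodMk hf]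
  -- The values of f lie in an arbitrary measurable space, so a regular conditional law is not
  -- available a priori. Finite mutual information provides a density ρ, and ρ(a, b) P_f(da) serves
  -- as the conditional law of f given g = b.
  set ρ := (Q.map fun ω => (f ω, g ω)).rnDeriv ((Q.map f).prod (Q.map g)) with hρ
  have hρm : Measurable ρ := Measure.measurable_rnDeriv _ _
  have hdens : ((Q.map f).prod (Q.map g)).withDensity ρ = Q.map fun ω => (f ω, g ω) :=
    Measure.withDensity_rnDeriv_eq _ _ (klDiv_ne_top_iff.1 hfin).1
  set T : A × (B × C) → A × B := fun z => (z.1, z.2.1) with hT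
  have hTm : Measurable T := by fun_prop
  have hρT : Measurable fun z => ρ (T z) := hρm.comp hTm
  have hTQ : (Q.map fun ω => (f ω, (g ω, h ω))).map T = Q.map fun ω => (f ω, g ω) := by
    rw [Measure.map_map hTm (hf.prodMk hgh)]; rfl
  have hTν : ((Q.map f).prod (Q.map fun ω => (g ω, h ω))).map T = (Q.map f).prod (Q.map g) := by
    have : T = Prod.map id Prod.fst := rfl
    rw [this, ← Measure.map_prod_map _ _ measurable_id measurable_fst, Measure.map_id,
      Measure.map_map measurable_fst hgh]
    rfl
  have hchain := fun hac => klDiv_eq_add_klDiv_map (μ := Q.map fun ω => (f ω, (g ω, h ω)))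
    (ν := (Q.map f).prod (Q.map fun ω => (g ω, h ω))) hac hTm
  rw [hTQ, hTν] at hchain
  -- This is the law that (f, g, h) would have if f depended on (g, h) through g only. By the chain
  -- rule the excess of I(f; g, h) over I(f; g) is the divergence from ν', which vanishes iff the
  -- actual law is ν'.
  set ν' := ((Q.map f).prod (Q.map fun ω => (g ω, h ω))).withDensity fun z => ρ (T z) with hν'
  -- the density of the conditional law of `f` given `g`
  have hkm : ∀ s : Set A, Measurable fun b => ∫⁻ a in s, ρ (a, b) ∂(Q.map f) := fun s =>
    hρm.lintegral_prod_left'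
  have hrect : ∀ (s : Set A) (E : Set (B × C)), MeasurableSet s → MeasurableSet E →
      ν' (s ×ˢ E) = ∫⁻ ω in (fun ω => (g ω, h ω)) ⁻¹' E,
        (∫⁻ a in s, ρ (a, g ω) ∂(Q.map f)) ∂Q := by
    intro s E hs hE
    rw [hν', withDensity_apply _ (hs.prod hE), ← Measure.prod_restrict,
      lintegral_prod_symm' _ hρT]
    exact setLIntegral_map hE ((hkm s).comp measurable_fst) hgh
  have hrect' : ∀ (s : Set A) (D : Set B), MeasurableSet s → MeasurableSet D →
      Q (f ⁻¹' s ∩ g ⁻¹' D) = ∫⁻ ω in g ⁻¹' D, (∫⁻ a in s, ρ (a, g ω) ∂(Q.map f)) ∂Q := by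
    intro s D hs hD
    have := congrArg (fun μ => μ (s ×ˢ D)) hdens
    rw [withDensity_apply _ (hs.prod hD), ← Measure.prod_restrict, lintegral_prod_symm' _ hρm,
      Measure.map_apply (hf.prodMk hg) (hs.prod hD), setLIntegral_map hD (hkm s) hg] at this
    exact this.symm
  have hcond : ∀ s, MeasurableSet s → Q⟦f ⁻¹' s | mB.comap g⟧ =ᵐ[Q]
      fun ω => (∫⁻ a in s, ρ (a, g ω) ∂(Q.map f)).toReal := fun s hs =>
    condProb_ae_eq_toReal hg (hf hs) (hkm s) (hrect' s · hs)
  have hiff : CondLawEq Q f g h ↔ Q.map (fun ω => (f ω, (g ω, h ω))) = ν' := by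
    constructor
    · intro H
      refine Measure.ext_prod fun {s E} hs hE => ?_
      have hfinite : ∀ᵐ ω ∂Q, ∫⁻ a in s, ρ (a, g ω) ∂(Q.map f) < ∞ := by
        refine ae_lt_top ((hkm s).comp hg) ?_
        have := hrect' s Set.univ hs MeasurableSet.univ
        rw [Set.preimage_univ, Set.inter_univ, Measure.restrict_univ] at this
        exact this ▸ measure_ne_top _ _
      rw [hrect s E hs hE, Measure.map_apply (hf.prodMk hgh) (hs.prod hE)]
      exact measure_inter_of_condProb_ae_eq (hf hs) hfinite hgh.comap_le ⟨E, hE, rfl⟩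
        ((H s hs).trans (hcond s hs))
    · intro H s hs
      refine EventuallyEq.trans ?_ (hcond s hs).symm
      refine condProb_ae_eq_toReal hgh (hf hs) ((hkm s).comp measurable_fst) fun E hE => ?_
      have := congrArg (fun μ => μ (s ×ˢ E)) H
      rw [hrect s E hs hE, Measure.map_apply (hf.prodMk hgh) (hs.prod hE)] at this
      exact this
  rw [hiff]
  constructor
  · intro H
    have hac : Q.map (fun ω => (f ω, (g ω, h ω))) ≪
        (Q.map f).prod (Q.map fun ω => (g ω, h ω)) := by
      rw [H]; exact withDensity_absolutelyContinuous _ _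
    rw [hchain hac]
    nth_rewrite 1 [H]
    have : SigmaFinite ν' := by rw [← H]; infer_instance
    rw [klDiv_self, zero_add]
  · intro H
    have hac := (klDiv_ne_top_iff.1 (H ▸ hfin)).1
    have h0 := hchain hac
    rw [H] at h0
    have : IsFiniteMeasure ν' := by
      refine isFiniteMeasure_withDensity ?_
      rw [← lintegral_map hρm hTm, hTν]
      exact ((Measure.lintegral_rnDeriv_le).trans_lt (measure_lt_top _ _)).ne
    refine klDiv_eq_zero_iff.1 ?_
    have h1 : 0 + klDiv (Q.map fun ω => (f ω, g ω)) ((Q.map f).prod (Q.map g)) = _ :=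
      (zero_add _).trans h0
    exact ((ENNReal.add_left_inj hfin).1 h1).symm

end CondProb

/-- The compensation identity: replacing the second marginal by another law `σ` in the product of
the marginals costs exactly the divergence of the second marginal from `σ`. -/
theorem klDiv_fst_prod {A B : Type*} [MeasurableSpace A] [MeasurableSpace B]
    (μ : Measure (A × B)) [IsProbabilityMeasure μ] (σ : Measure B) [IsProbabilityMeasure σ] :
    klDiv μ (μ.fst.prod σ) = mutualInfo μ + klDiv μ.snd σ := by
  have hsnd : (μ.fst.prod σ).map Prod.snd = σ := by
    rw [← Measure.snd, Measure.snd_prod]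
  by_cases hac : μ ≪ μ.fst.prod σ
  · have hσ : μ.snd ≪ σ := by
      have := hac.map (measurable_snd (α := A) (β := B))
      rwa [hsnd] at this
    -- Tilting P_A × σ along the second coordinate so that its second marginal becomes that of μ
    -- yields the product of the marginals of μ.
    rw [klDiv_eq_add_klDiv_map hac measurable_snd, hsnd, ← Measure.snd,
      ← prod_withDensity_right (Measure.measurable_rnDeriv _ _),
      Measure.withDensity_rnDeriv_eq _ _ hσ, mutualInfo]
  · rw [klDiv_of_not_ac hac]
    symm
    -- If both terms on the right were finite, μ would be absolutely continuous with respect to the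
    -- product of its marginals, and that product with respect to P_A × σ.
    by_contra h
    rw [← ne_eq, ENNReal.add_ne_top, mutualInfo, klDiv_ne_top_iff, klDiv_ne_top_iff] at h
    exact hac (h.1.1.trans (Measure.AbsolutelyContinuous.rfl.prod h.2.1))

end GrayWyner

namespace InformationTheory

/-! ### Divergence from products of two kernels: additivity and superadditivity. -/

section ProdKernel

variable {U V V₁ V₂ Y Y₁ Y₂ : Type*} {mU : MeasurableSpace U} {mV : MeasurableSpace V}
  {mV₁ : MeasurableSpace V₁} {mV₂ : MeasurableSpace V₂} {mY : MeasurableSpace Y}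
  {mY₁ : MeasurableSpace Y₁} {mY₂ : MeasurableSpace Y₂}

lemma map_compProd_comap (μ : Measure U) [IsFiniteMeasure μ] (κ : Kernel V Y) [IsMarkovKernel κ]
    {p : U → V} (hp : Measurable p) :
    (μ ⊗ₘ κ.comap p hp).map (fun z => (p z.1, z.2)) = μ.map p ⊗ₘ κ := by
  refine Measure.ext_prod fun {s t} hs ht => ?_
  rw [Measure.map_apply (by fun_prop) (hs.prod ht), Measure.compProd_apply_prod hs ht,
    setLIntegral_map hs (Kernel.measurable_coe κ ht) hp]
  exact Measure.compProd_apply_prod (hp hs) ht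

lemma map_prodAssoc_symm_compProd_prod (μ : Measure U) (κ : Kernel U Y₁) (η : Kernel U Y₂)
    [IsMarkovKernel κ] [IsMarkovKernel η] :
    (μ ⊗ₘ (κ ×ₖ η)).map MeasurableEquiv.prodAssoc.symm =
      (μ ⊗ₘ κ) ⊗ₘ η.comap Prod.fst measurable_fst := by
  rw [← Measure.compProd_assoc]
  congr 2
  ext u s hs
  rw [Kernel.prod_apply, Kernel.compProd_apply hs, Measure.prod_apply hs]
  rfl

/-- Chain rule, one output at a time. The second pair of kernels ignores the first output, so its
term depends only on the law of p₂. -/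
lemma klDiv_compProd_prod [StandardBorelSpace Y₁] [StandardBorelSpace Y₂] (μ : Measure U)
    [IsFiniteMeasure μ] (κ₁ η₁ : Kernel V₁ Y₁) (κ₂ η₂ : Kernel V₂ Y₂) [IsMarkovKernel κ₁]
    [IsMarkovKernel η₁] [IsMarkovKernel κ₂] [IsMarkovKernel η₂] {p₁ : U → V₁} {p₂ : U → V₂}
    (hp₁ : Measurable p₁) (hp₂ : Measurable p₂) :
    klDiv (μ ⊗ₘ (κ₁.comap p₁ hp₁ ×ₖ κ₂.comap p₂ hp₂)) (μ ⊗ₘ (η₁.comap p₁ hp₁ ×ₖ η₂.comap p₂ hp₂)) =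
      klDiv (μ.map p₁ ⊗ₘ κ₁) (μ.map p₁ ⊗ₘ η₁) + klDiv (μ.map p₂ ⊗ₘ κ₂) (μ.map p₂ ⊗ₘ η₂) := by
  rw [← klDiv_map_measurableEquiv _ _ MeasurableEquiv.prodAssoc.symm,
    map_prodAssoc_symm_compProd_prod, map_prodAssoc_symm_compProd_prod, klDiv_compProd_eq_add,
    klDiv_compProd_comap]
  congr 1
  have h := klDiv_compProd_comap (μ ⊗ₘ κ₁.comap p₁ hp₁) κ₂ η₂ (hp₂.comp measurable_fst)
  rw [← Measure.map_map hp₂ measurable_fst, ← Measure.fst, Measure.fst_compProd] at h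
  exact h

/-- Superadditivity of the Kullback-Leibler divergence from a law under which the two last
components are conditionally independent. -/
lemma klDiv_add_klDiv_le [StandardBorelSpace Y₂] [Nonempty Y₂] (Q : Measure (U × (Y₁ × Y₂)))
    [IsProbabilityMeasure Q] (η₁ : Kernel V₁ Y₁) (η₂ : Kernel V₂ Y₂)
    [IsMarkovKernel η₁] [IsMarkovKernel η₂] {p₁ : U → V₁} {p₂ : U → V₂}
    (hp₁ : Measurable p₁) (hp₂ : Measurable p₂) :
    klDiv (Q.map fun z => (p₁ z.1, z.2.1)) (Q.fst.map p₁ ⊗ₘ η₁) +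
      klDiv (Q.map fun z => (p₂ z.1, z.2.2)) (Q.fst.map p₂ ⊗ₘ η₂) ≤
      klDiv Q (Q.fst ⊗ₘ (η₁.comap p₁ hp₁ ×ₖ η₂.comap p₂ hp₂)) := by
  rw [← klDiv_map_measurableEquiv Q _ MeasurableEquiv.prodAssoc.symm,
    map_prodAssoc_symm_compProd_prod]
  set R := Q.map MeasurableEquiv.prodAssoc.symm with hR
  have : IsProbabilityMeasure R :=
    Measure.isProbabilityMeasure_map MeasurableEquiv.prodAssoc.symm.measurable.aemeasurable
  have hR1 : R.fst = Q.map fun z => (z.1, z.2.1) :=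
    Measure.map_map measurable_fst MeasurableEquiv.prodAssoc.symm.measurable
  have hR11 : R.fst.map Prod.fst = Q.fst := by
    rw [hR1, Measure.map_map measurable_fst (by fun_prop)]; rfl
  -- Reveal Y₁ first, then Y₂ given (U, Y₁). Data processing bounds each term below: the first by
  -- keeping only (p₁, Y₁), the second by keeping only (p₂, Y₂), since the reference kernel for Y₂
  -- ignores Y₁.
  have hchain := klDiv_compProd_eq_add R.fst (Q.fst ⊗ₘ η₁.comap p₁ hp₁) R.condKernel
    (η₂.comap (fun z : U × Y₁ => p₂ z.1) (hp₂.comp measurable_fst))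
  rw [Measure.disintegrate] at hchain
  refine le_of_le_of_eq (add_le_add ?_ ?_) hchain.symm
  · have h := klDiv_map_le R.fst (Q.fst ⊗ₘ η₁.comap p₁ hp₁)
      (g := fun z => (p₁ z.1, z.2)) (by fun_prop)
    rw [map_compProd_comap, hR1, Measure.map_map (by fun_prop) (by fun_prop)] at h
    rw [hR1]
    exact h
  · have h := klDiv_map_le R (R.fst ⊗ₘ η₂.comap (fun z : U × Y₁ => p₂ z.1)
      (hp₂.comp measurable_fst)) (g := fun z => (p₂ z.1.1, z.2)) (by fun_prop)
    have hmap : (R.fst ⊗ₘ η₂.comap (fun z : U × Y₁ => p₂ z.1) (hp₂.comp measurable_fst)).map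
        (fun z => (p₂ z.1.1, z.2)) = Q.fst.map p₂ ⊗ₘ η₂ := by
      rw [← hR11, Measure.map_map hp₂ measurable_fst]
      exact map_compProd_comap R.fst η₂ (hp₂.comp measurable_fst)
    rw [hmap, hR, Measure.map_map (by fun_prop) MeasurableEquiv.prodAssoc.symm.measurable] at h
    exact h

end ProdKernel

end InformationTheory

/-! ### The fundamental information identity. -/

namespace GrayWyner

/-- Two ways of splitting the divergence of the law `Q` of `((X, W), Y)` from the law
`P_X P_W η`: by the law of `(X, W)` first, or by `X` against `(Y, W)`. -/
theorem mutualInfo_fst_add_klDiv {X W Y : Type*} [MeasurableSpace X] [MeasurableSpace W]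
    [MeasurableSpace Y] [StandardBorelSpace Y] [Nonempty Y] (Q : Measure ((X × W) × Y))
    [IsProbabilityMeasure Q] (η : Kernel W Y) [IsMarkovKernel η] :
    mutualInfo Q.fst + klDiv Q (Q.fst ⊗ₘ Kernel.prodMkLeft X η) =
      mutualInfo (Q.map fun z => (z.1.1, (z.2, z.1.2))) +
        klDiv (Q.map fun z => (z.1.2, z.2)) (Q.fst.snd ⊗ₘ η) := by
  let e : (X × W) × Y ≃ᵐ X × (Y × W) :=
    MeasurableEquiv.prodAssoc.trans ((MeasurableEquiv.refl X).prodCongr MeasurableEquiv.prodComm)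
  have he : ⇑e = fun z => (z.1.1, (z.2, z.1.2)) := rfl
  have hchain := klDiv_compProd_eq_add Q.fst (Q.fst.fst.prod Q.fst.snd) Q.condKernel
    (Kernel.prodMkLeft X η)
  rw [Measure.disintegrate] at hchain
  rw [mutualInfo, ← hchain, ← klDiv_map_measurableEquiv _ _ e]
  have hprob : IsProbabilityMeasure (Q.map e) :=
    Measure.isProbabilityMeasure_map e.measurable.aemeasurable
  have hprob' : IsProbabilityMeasure ((Q.fst.snd ⊗ₘ η).map Prod.swap) :=
    Measure.isProbabilityMeasure_map measurable_swap.aemeasurable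
  have hfst : (Q.map e).fst = Q.fst.fst := by
    rw [Measure.fst, Measure.map_map measurable_fst e.measurable, Measure.fst, Measure.fst,
      Measure.map_map measurable_fst measurable_fst]
    rfl
  -- After reordering coordinates the reference law P_X P_W η is the product of P_X with a law of
  -- (Y, W), so the compensation identity `klDiv_fst_prod` applies.
  have hS : ((Q.fst.fst.prod Q.fst.snd) ⊗ₘ Kernel.prodMkLeft X η).map e =
      (Q.map e).fst.prod ((Q.fst.snd ⊗ₘ η).map Prod.swap) := by
    rw [hfst]
    refine Measure.ext_prod₃ fun {s t u} hs ht hu => ?_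
    rw [Measure.map_apply e.measurable (hs.prod (ht.prod hu)), Measure.prod_prod,
      Measure.map_apply measurable_swap (ht.prod hu), Set.preimage_swap_prod,
      Measure.compProd_apply_prod hu ht]
    have hset : e ⁻¹' (s ×ˢ t ×ˢ u) = (s ×ˢ u) ×ˢ t := by
      ext z
      simp only [he, Set.mem_preimage, Set.mem_prod]
      tauto
    have hm : Measurable fun w => η w t := Kernel.measurable_coe η ht
    rw [hset, Measure.compProd_apply_prod (hs.prod hu) ht, ← Measure.prod_restrict]
    simp only [Kernel.prodMkLeft_apply]
    rw [lintegral_prod _ (by fun_prop)]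
    simp [mul_comm]
  rw [hS, klDiv_fst_prod]
  congr 1
  have hsnd : (Q.map e).snd = (Q.map fun z => (z.1.2, z.2)).map MeasurableEquiv.prodComm := by
    rw [Measure.snd, Measure.map_map measurable_snd e.measurable,
      Measure.map_map MeasurableEquiv.prodComm.measurable (by fun_prop)]
    rfl
  rw [hsnd]
  exact klDiv_map_measurableEquiv _ _ _

end GrayWyner

/-! ### The inequality in (*) and its equality case. -/

namespace GrayWyner

lemma mutualInfo_map_le {A B C : Type*} [MeasurableSpace A] [MeasurableSpace B]
    [MeasurableSpace C] (μ : Measure (A × C)) [IsProbabilityMeasure μ] {φ : C → B}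
    (hφ : Measurable φ) : mutualInfo (μ.map fun z => (z.1, φ z.2)) ≤ mutualInfo μ := by
  have h := klDiv_map_le μ (μ.fst.prod μ.snd) (g := Prod.map id φ) (by fun_prop)
  rw [← Measure.map_prod_map _ _ measurable_id hφ, Measure.map_id] at h
  rw [mutualInfo, Measure.fst_map_prodMk (by fun_prop), Measure.snd_map_prodMk (by fun_prop)]
  rwa [Measure.snd, Measure.map_map hφ measurable_snd] at h

section Cond

variable {A B C : Type*} [MeasurableSpace A] [MeasurableSpace B] [MeasurableSpace C]
  [StandardBorelSpace B] [Nonempty B]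

/-- Isolates the two properties of the conditional law of B given C that are used: it is the
reference kernel in the conditional information, and it generates the law of (C, B). -/
lemma exists_kernel_condMutualInfo_eq (ν : Measure (A × C)) [IsProbabilityMeasure ν]
    (κ : Kernel (A × C) B) [IsMarkovKernel κ] :
    ∃ η : Kernel C B, IsMarkovKernel η ∧
      condMutualInfo (ν ⊗ₘ κ) = klDiv (ν ⊗ₘ κ) (ν ⊗ₘ Kernel.prodMkLeft A η) ∧
      (ν ⊗ₘ κ).map (fun z => (z.1.2, z.2)) = ν.snd ⊗ₘ η := by
  refine ⟨condDistrib (fun z : (A × C) × B => z.2) (fun z => z.1.2) (ν ⊗ₘ κ), inferInstance,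
    ?_, ?_⟩
  · rw [condMutualInfo, Measure.fst_compProd]
  · have hsnd : (ν ⊗ₘ κ).map (fun z => z.1.2) = ν.snd := by
      rw [← Measure.fst_compProd (μ := ν) (κ := κ), Measure.snd, Measure.fst,
        Measure.map_map measurable_snd measurable_fst, ← Measure.fst, Measure.fst_compProd]
      rfl
    rw [← compProd_map_condDistrib measurable_snd.aemeasurable, hsnd]

end Cond

variable {X₁ X₂ Y₁ Y₂ W : Type*} [MeasurableSpace X₁] [MeasurableSpace X₂] [MeasurableSpace Y₁]
  [MeasurableSpace Y₂] [MeasurableSpace W]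

instance (ν : Measure ((X₁ × X₂) × W)) [IsProbabilityMeasure ν] :
    IsProbabilityMeasure (law₁ ν) :=
  Measure.isProbabilityMeasure_map (by fun_prop)

instance (ν : Measure ((X₁ × X₂) × W)) [IsProbabilityMeasure ν] :
    IsProbabilityMeasure (law₂ ν) :=
  Measure.isProbabilityMeasure_map (by fun_prop)

lemma snd_law₁ (ν : Measure ((X₁ × X₂) × W)) : (law₁ ν).snd = ν.snd := by
  rw [law₁, Measure.snd, Measure.map_map measurable_snd (by fun_prop)]; rfl

lemma snd_law₂ (ν : Measure ((X₁ × X₂) × W)) : (law₂ ν).snd = ν.snd := by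
  rw [law₂, Measure.snd, Measure.map_map measurable_snd (by fun_prop)]; rfl

lemma prodMkLeft_prod (η₁ : Kernel W Y₁) (η₂ : Kernel W Y₂) [IsMarkovKernel η₁]
    [IsMarkovKernel η₂] :
    Kernel.prodMkLeft (X₁ × X₂) (η₁ ×ₖ η₂) =
      (Kernel.prodMkLeft X₁ η₁).comap (fun z : (X₁ × X₂) × W => (z.1.1, z.2)) (by fun_prop) ×ₖ
        (Kernel.prodMkLeft X₂ η₂).comap (fun z : (X₁ × X₂) × W => (z.1.2, z.2)) (by fun_prop) := by
  ext z : 1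
  simp [Kernel.prod_apply]

lemma jointRDF_le {P : Measure (X₁ × X₂)} {D₁ : X₁ → Y₁ → ℝ≥0∞} {D₂ : X₂ → Y₂ → ℝ≥0∞}
    {Δ₁ Δ₂ : ℝ≥0} (κ : Kernel (X₁ × X₂) (Y₁ × Y₂)) (hM : IsMarkovKernel κ)
    (hκ : JointFeasible P D₁ D₂ Δ₁ Δ₂ κ) : jointRDF P D₁ D₂ Δ₁ Δ₂ ≤ mutualInfo (P ⊗ₘ κ) :=
  iInf_le_of_le κ (iInf_le_of_le hM (iInf_le _ hκ))

lemma mutualInfo_map_fst_le (Q : Measure (((X₁ × X₂) × W) × (Y₁ × Y₂)))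
    [IsProbabilityMeasure Q] :
    mutualInfo (Q.map fun z => (z.1.1, z.2)) ≤
      mutualInfo (Q.map fun z => (z.1.1, (z.2, z.1.2))) := by
  have hm : Measurable fun z : ((X₁ × X₂) × W) × (Y₁ × Y₂) => (z.1.1, (z.2, z.1.2)) := by
    fun_prop
  have := Measure.isProbabilityMeasure_map (μ := Q) hm.aemeasurable
  have h := mutualInfo_map_le (Q.map fun z => (z.1.1, (z.2, z.1.2)))
    (measurable_fst (α := Y₁ × Y₂) (β := W))
  rwa [Measure.map_map (by fun_prop) hm] at h

variable [StandardBorelSpace Y₁] [Nonempty Y₁] [StandardBorelSpace Y₂] [Nonempty Y₂]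

/-- The coupling of `((X₁, X₂), W)` with the outputs `Y₁`, `Y₂` of the channels `κ₁`, `κ₂`, used
independently, and its information balance. -/
theorem exists_coupling (ν : Measure ((X₁ × X₂) × W)) [IsProbabilityMeasure ν]
    (κ₁ : Kernel (X₁ × W) Y₁) (κ₂ : Kernel (X₂ × W) Y₂) [IsMarkovKernel κ₁] [IsMarkovKernel κ₂] :
    ∃ (Q : Measure (((X₁ × X₂) × W) × (Y₁ × Y₂))) (η₁ : Kernel W Y₁) (η₂ : Kernel W Y₂),
      IsProbabilityMeasure Q ∧ IsMarkovKernel η₁ ∧ IsMarkovKernel η₂ ∧ Q.fst = ν ∧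
      Q.map (fun z => ((z.1.1.1, z.1.2), z.2.1)) = law₁ ν ⊗ₘ κ₁ ∧
      Q.map (fun z => ((z.1.1.2, z.1.2), z.2.2)) = law₂ ν ⊗ₘ κ₂ ∧
      Q.map (fun z => (z.1.2, z.2.1)) = ν.snd ⊗ₘ η₁ ∧
      Q.map (fun z => (z.1.2, z.2.2)) = ν.snd ⊗ₘ η₂ ∧
      mutualInfo ν + (condMutualInfo (law₁ ν ⊗ₘ κ₁) + condMutualInfo (law₂ ν ⊗ₘ κ₂)) =
        mutualInfo (Q.map fun z => (z.1.1, (z.2, z.1.2))) +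
          klDiv (Q.map fun z => (z.1.2, z.2)) (ν.snd ⊗ₘ (η₁ ×ₖ η₂)) := by
  obtain ⟨η₁, hη₁, hI₁, hm₁⟩ := exists_kernel_condMutualInfo_eq (law₁ ν) κ₁
  obtain ⟨η₂, hη₂, hI₂, hm₂⟩ := exists_kernel_condMutualInfo_eq (law₂ ν) κ₂
  have hp₁ : Measurable fun z : (X₁ × X₂) × W => (z.1.1, z.2) := by fun_prop
  have hp₂ : Measurable fun z : (X₁ × X₂) × W => (z.1.2, z.2) := by fun_prop
  set Q := ν ⊗ₘ (κ₁.comap _ hp₁ ×ₖ κ₂.comap _ hp₂) with hQ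
  have hfst : Q.fst = ν := Measure.fst_compProd _ _
  have hQ₁ : Q.map (fun z => ((z.1.1.1, z.1.2), z.2.1)) = law₁ ν ⊗ₘ κ₁ := by
    have h : Q.map (fun z => (z.1, z.2.1)) = ν ⊗ₘ κ₁.comap _ hp₁ := by
      have := Measure.compProd_map (μ := ν) (κ := κ₁.comap _ hp₁ ×ₖ κ₂.comap _ hp₂)
        measurable_fst
      rw [← Kernel.fst_eq, Kernel.fst_prod] at this
      exact this.symm
    rw [← map_compProd_comap ν κ₁ hp₁, ← h, Measure.map_map (by fun_prop) (by fun_prop)]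
    rfl
  have hQ₂ : Q.map (fun z => ((z.1.1.2, z.1.2), z.2.2)) = law₂ ν ⊗ₘ κ₂ := by
    have h : Q.map (fun z => (z.1, z.2.2)) = ν ⊗ₘ κ₂.comap _ hp₂ := by
      have := Measure.compProd_map (μ := ν) (κ := κ₁.comap _ hp₁ ×ₖ κ₂.comap _ hp₂)
        measurable_snd
      rw [← Kernel.snd_eq, Kernel.snd_prod] at this
      exact this.symm
    rw [← map_compProd_comap ν κ₂ hp₂, ← h, Measure.map_map (by fun_prop) (by fun_prop)]
    rfl
  refine ⟨Q, η₁, η₂, inferInstance, hη₁, hη₂, hfst, hQ₁, hQ₂, ?_, ?_, ?_⟩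
  · rw [← snd_law₁ ν, ← hm₁, ← hQ₁, Measure.map_map (by fun_prop) (by fun_prop)]; rfl
  · rw [← snd_law₂ ν, ← hm₂, ← hQ₂, Measure.map_map (by fun_prop) (by fun_prop)]; rfl
  · have h := mutualInfo_fst_add_klDiv Q (η₁ ×ₖ η₂)
    rw [hfst] at h
    rw [← h, prodMkLeft_prod, hQ, klDiv_compProd_prod, hI₁, hI₂]

/-- Here the outputs need not be conditionally independent given (X₁, X₂, W), so additivity weakens
to superadditivity. Conditional independence given W removes the divergence on the other side of the
identity. -/
theorem mutualInfo_add_condMutualInfo_le (Q : Measure (((X₁ × X₂) × W) × (Y₁ × Y₂)))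
    [IsProbabilityMeasure Q] (κ₁ : Kernel (X₁ × W) Y₁) (κ₂ : Kernel (X₂ × W) Y₂)
    [IsMarkovKernel κ₁] [IsMarkovKernel κ₂]
    (hQ₁ : Q.map (fun z => ((z.1.1.1, z.1.2), z.2.1)) = law₁ Q.fst ⊗ₘ κ₁)
    (hQ₂ : Q.map (fun z => ((z.1.1.2, z.1.2), z.2.2)) = law₂ Q.fst ⊗ₘ κ₂)
    (hind : CondIndepGiven Q (fun z => z.2.1) (fun z => z.2.2) (fun z => z.1.2)) :
    mutualInfo Q.fst +
        (condMutualInfo (law₁ Q.fst ⊗ₘ κ₁) + condMutualInfo (law₂ Q.fst ⊗ₘ κ₂)) ≤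
      mutualInfo (Q.map fun z => (z.1.1, (z.2, z.1.2))) := by
  obtain ⟨η₁, hη₁, hI₁, hm₁⟩ := exists_kernel_condMutualInfo_eq (law₁ Q.fst) κ₁
  obtain ⟨η₂, hη₂, hI₂, hm₂⟩ := exists_kernel_condMutualInfo_eq (law₂ Q.fst) κ₂
  have hsnd : Q.fst.snd = Q.map fun z => z.1.2 := Measure.map_map measurable_snd measurable_fst
  rw [snd_law₁, hsnd, ← hQ₁, Measure.map_map (by fun_prop) (by fun_prop)] at hm₁
  rw [snd_law₂, hsnd, ← hQ₂, Measure.map_map (by fun_prop) (by fun_prop)] at hm₂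
  rw [condIndepGiven_iff (by fun_prop) (by fun_prop) (by fun_prop) hm₁ hm₂, ← hsnd] at hind
  have h := mutualInfo_fst_add_klDiv Q (η₁ ×ₖ η₂)
  have hz : klDiv (Q.map fun z => (z.1.2, z.2)) (Q.fst.snd ⊗ₘ (η₁ ×ₖ η₂)) = 0 := by
    rw [← hind]; exact klDiv_self _
  rw [hz, add_zero] at h
  rw [← h, hI₁, hI₂, prodMkLeft_prod, ← hQ₁, ← hQ₂]
  gcongr
  exact klDiv_add_klDiv_le Q _ _ _ _

/-- If the marginals of `Q` are generated by feasible channels given `W`, then its marginal on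
`((X₁, X₂), (Y₁, Y₂))` is generated by a feasible channel. -/
lemma exists_jointFeasible {D₁ : X₁ → Y₁ → ℝ≥0∞} {D₂ : X₂ → Y₂ → ℝ≥0∞}
    (hD₁ : Measurable (Function.uncurry D₁)) (hD₂ : Measurable (Function.uncurry D₂))
    {Δ₁ Δ₂ : ℝ≥0} (Q : Measure (((X₁ × X₂) × W) × (Y₁ × Y₂))) [IsProbabilityMeasure Q]
    {κ₁ : Kernel (X₁ × W) Y₁} {κ₂ : Kernel (X₂ × W) Y₂}
    (hQ₁ : Q.map (fun z => ((z.1.1.1, z.1.2), z.2.1)) = law₁ Q.fst ⊗ₘ κ₁)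
    (hQ₂ : Q.map (fun z => ((z.1.1.2, z.1.2), z.2.2)) = law₂ Q.fst ⊗ₘ κ₂)
    (hκ₁ : CondFeasible (law₁ Q.fst) D₁ Δ₁ κ₁) (hκ₂ : CondFeasible (law₂ Q.fst) D₂ Δ₂ κ₂) :
    ∃ κ : Kernel (X₁ × X₂) (Y₁ × Y₂), IsMarkovKernel κ ∧
      JointFeasible Q.fst.fst D₁ D₂ Δ₁ Δ₂ κ ∧
      Q.map (fun z => (z.1.1, z.2)) = Q.fst.fst ⊗ₘ κ := by
  have hm : Measurable fun z : ((X₁ × X₂) × W) × (Y₁ × Y₂) => (z.1.1, z.2) := by fun_prop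
  have := Measure.isProbabilityMeasure_map (μ := Q) hm.aemeasurable
  have hfst : (Q.map fun z => (z.1.1, z.2)).fst = Q.fst.fst := by
    rw [Measure.fst_map_prodMk measurable_snd, Measure.fst, Measure.fst,
      Measure.map_map measurable_fst measurable_fst]
    rfl
  have hdis : Q.fst.fst ⊗ₘ (Q.map fun z => (z.1.1, z.2)).condKernel =
      Q.map fun z => (z.1.1, z.2) := by
    rw [← hfst, Measure.disintegrate]
  refine ⟨(Q.map fun z => (z.1.1, z.2)).condKernel, inferInstance, ⟨?_, ?_⟩, hdis.symm⟩
  · have hD : Measurable fun z : (X₁ × W) × Y₁ => D₁ z.1.1 z.2 :=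
      hD₁.comp (f := fun z : (X₁ × W) × Y₁ => (z.1.1, z.2)) (by fun_prop)
    have hD' : Measurable fun z : (X₁ × X₂) × (Y₁ × Y₂) => D₁ z.1.1 z.2.1 :=
      hD₁.comp (f := fun z : (X₁ × X₂) × (Y₁ × Y₂) => (z.1.1, z.2.1)) (by fun_prop)
    rw [CondFeasible, ← hQ₁, lintegral_map hD (by fun_prop)] at hκ₁
    rwa [hdis, lintegral_map hD' hm]
  · have hD : Measurable fun z : (X₂ × W) × Y₂ => D₂ z.1.1 z.2 :=
      hD₂.comp (f := fun z : (X₂ × W) × Y₂ => (z.1.1, z.2)) (by fun_prop)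
    have hD' : Measurable fun z : (X₁ × X₂) × (Y₁ × Y₂) => D₂ z.1.2 z.2.2 :=
      hD₂.comp (f := fun z : (X₁ × X₂) × (Y₁ × Y₂) => (z.1.2, z.2.2)) (by fun_prop)
    rw [CondFeasible, ← hQ₂, lintegral_map hD (by fun_prop)] at hκ₂
    rwa [hdis, lintegral_map hD' hm]

/-- Moving a to the left by truncated subtraction lets the infimum be bounded channel by channel,
without attainment or finiteness of a. -/
lemma le_add_condRDF {A B C : Type*} [MeasurableSpace A] [MeasurableSpace B] [MeasurableSpace C]
    [StandardBorelSpace B] [Nonempty B] {ν : Measure (A × C)} [IsFiniteMeasure ν]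
    {D : A → B → ℝ≥0∞} {Δ : ℝ≥0} {r a : ℝ≥0∞}
    (h : ∀ (κ : Kernel (A × C) B) (_ : IsMarkovKernel κ), CondFeasible ν D Δ κ →
      r ≤ a + condMutualInfo (ν ⊗ₘ κ)) : r ≤ a + condRDF ν D Δ := by
  rw [← tsub_le_iff_left, condRDF]
  exact le_iInf fun κ => le_iInf fun hκ => le_iInf fun hf => tsub_le_iff_left.2 (h κ hκ hf)

/-- For any feasible pair of channels, the coupling has an output feasible for the joint problem,
and its information balance dominates I(X;Y,W) ≥ I(X;Y). -/
theorem jointRDF_le_add (ν : Measure ((X₁ × X₂) × W)) [IsProbabilityMeasure ν]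
    {D₁ : X₁ → Y₁ → ℝ≥0∞} {D₂ : X₂ → Y₂ → ℝ≥0∞}
    (hD₁ : Measurable (Function.uncurry D₁)) (hD₂ : Measurable (Function.uncurry D₂))
    (Δ₁ Δ₂ : ℝ≥0) :
    jointRDF ν.fst D₁ D₂ Δ₁ Δ₂ ≤
      mutualInfo ν + (condRDF (law₁ ν) D₁ Δ₁ + condRDF (law₂ ν) D₂ Δ₂) := by
  rw [← add_assoc]
  refine le_add_condRDF fun κ₂ hM₂ hκ₂ => ?_
  rw [add_right_comm]
  refine le_add_condRDF fun κ₁ hM₁ hκ₁ => ?_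
  rw [add_right_comm, add_assoc]
  obtain ⟨Q, η₁, η₂, hQ, hη₁, hη₂, rfl, hQ₁, hQ₂, -, -, hsum⟩ := exists_coupling ν κ₁ κ₂
  obtain ⟨κ, hM, hκ, hQκ⟩ := exists_jointFeasible hD₁ hD₂ Q hQ₁ hQ₂ hκ₁ hκ₂
  calc _ ≤ mutualInfo (Q.map fun z => (z.1.1, z.2)) := hQκ ▸ jointRDF_le κ hM hκ
    _ ≤ mutualInfo (Q.map fun z => (z.1.1, (z.2, z.1.2))) := mutualInfo_map_fst_le Q
    _ ≤ _ := hsum ▸ le_self_add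

/-- The Markov condition gives I(X;Y,W) = I(X;Y), which is the joint rate distortion function
because the marginal comes from a test channel; conditional independence bounds the left side by
I(X;Y,W). -/
theorem add_eq_jointRDF_of_mem_distortionRegion (ν : Measure ((X₁ × X₂) × W))
    [IsProbabilityMeasure ν] {D₁ : X₁ → Y₁ → ℝ≥0∞} {D₂ : X₂ → Y₂ → ℝ≥0∞}
    (hD₁ : Measurable (Function.uncurry D₁)) (hD₂ : Measurable (Function.uncurry D₂))
    {Δ₁ Δ₂ : ℝ≥0} (h : (Δ₁, Δ₂) ∈ distortionRegion ν D₁ D₂) :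
    mutualInfo ν + (condRDF (law₁ ν) D₁ Δ₁ + condRDF (law₂ ν) D₂ Δ₂) =
      jointRDF ν.fst D₁ D₂ Δ₁ Δ₂ := by
  refine le_antisymm ?_ (jointRDF_le_add ν hD₁ hD₂ Δ₁ Δ₂)
  obtain ⟨Q, rfl, hind, hlaw, ⟨κ, ⟨hM, hκ, hopt⟩, hQκ⟩, ⟨κ₁, ⟨hM₁, hκ₁, hopt₁⟩, hQ₁⟩,
    ⟨κ₂, ⟨hM₂, hκ₂, hopt₂⟩, hQ₂⟩⟩ := h
  by_cases htop : jointRDF Q.fst.fst D₁ D₂ Δ₁ Δ₂ = ∞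
  · rw [htop]; exact le_top
  have hprob : IsProbabilityMeasure Q := by
    refine ⟨?_⟩
    rw [← Measure.fst_univ]
    exact measure_univ
  have hfin : mutualInfo (Q.map fun z => (z.1.1, z.2)) ≠ ∞ := by
    rw [hQκ, hopt]; exact htop
  rw [condLawEq_iff_mutualInfo_eq (by fun_prop) (by fun_prop) (by fun_prop) hfin] at hlaw
  rw [← hopt, ← hQκ, ← hlaw, ← hopt₁, ← hopt₂]
  exact mutualInfo_add_condMutualInfo_le Q κ₁ κ₂ hQ₁ hQ₂ hind

/-- The coupling of the two conditional test channels is the witness. Its information balance closes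
the chain R ≤ I(X;Y) ≤ I(X;Y,W) ≤ R, where R is the joint rate distortion function, so its joint
marginal is also optimal. -/
theorem mem_distortionRegion_of_add_eq_jointRDF (ν : Measure ((X₁ × X₂) × W))
    [IsProbabilityMeasure ν] {D₁ : X₁ → Y₁ → ℝ≥0∞} {D₂ : X₂ → Y₂ → ℝ≥0∞}
    (hD₁ : Measurable (Function.uncurry D₁)) (hD₂ : Measurable (Function.uncurry D₂))
    {Δ₁ Δ₂ : ℝ≥0} (htop : jointRDF ν.fst D₁ D₂ Δ₁ Δ₂ ≠ ∞)
    (h : mutualInfo ν + (condRDF (law₁ ν) D₁ Δ₁ + condRDF (law₂ ν) D₂ Δ₂) =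
      jointRDF ν.fst D₁ D₂ Δ₁ Δ₂)
    {κ₁ : Kernel (X₁ × W) Y₁} (h₁ : IsCondTestChannel (law₁ ν) D₁ Δ₁ κ₁)
    {κ₂ : Kernel (X₂ × W) Y₂} (h₂ : IsCondTestChannel (law₂ ν) D₂ Δ₂ κ₂) :
    (Δ₁, Δ₂) ∈ distortionRegion ν D₁ D₂ := by
  obtain ⟨hM₁, hκ₁, hopt₁⟩ := id h₁
  obtain ⟨hM₂, hκ₂, hopt₂⟩ := id h₂
  obtain ⟨Q, η₁, η₂, hQ, hη₁, hη₂, rfl, hQ₁, hQ₂, hm₁, hm₂, hsum⟩ := exists_coupling ν κ₁ κ₂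
  obtain ⟨κ, hM, hκ, hQκ⟩ := exists_jointFeasible hD₁ hD₂ Q hQ₁ hQ₂ hκ₁ hκ₂
  rw [hopt₁, hopt₂, h] at hsum
  have hle : jointRDF Q.fst.fst D₁ D₂ Δ₁ Δ₂ ≤ mutualInfo (Q.map fun z => (z.1.1, z.2)) :=
    hQκ ▸ jointRDF_le κ hM hκ
  have hle' := mutualInfo_map_fst_le Q
  have hle'' : mutualInfo (Q.map fun z => (z.1.1, (z.2, z.1.2))) ≤
      jointRDF Q.fst.fst D₁ D₂ Δ₁ Δ₂ := hsum ▸ le_self_add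
  have heq : mutualInfo (Q.map fun z => (z.1.1, z.2)) = jointRDF Q.fst.fst D₁ D₂ Δ₁ Δ₂ :=
    le_antisymm (hle'.trans hle'') hle
  have heq' : mutualInfo (Q.map fun z => (z.1.1, (z.2, z.1.2))) =
      jointRDF Q.fst.fst D₁ D₂ Δ₁ Δ₂ := le_antisymm hle'' (hle.trans hle')
  have hsnd : Q.fst.snd = Q.map fun z => z.1.2 := Measure.map_map measurable_snd measurable_fst
  refine ⟨Q, rfl, ?_, ?_, ⟨κ, ⟨hM, hκ, by rw [← hQκ, heq]⟩, hQκ⟩, ⟨κ₁, h₁, hQ₁⟩, ⟨κ₂, h₂, hQ₂⟩⟩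
  · have hm : Measurable fun z : ((X₁ × X₂) × W) × (Y₁ × Y₂) => (z.1.2, z.2) := by fun_prop
    have := Measure.isProbabilityMeasure_map (μ := Q) hm.aemeasurable
    have hz : klDiv (Q.map fun z => (z.1.2, z.2)) (Q.fst.snd ⊗ₘ (η₁ ×ₖ η₂)) = 0 := by
      rw [heq'] at hsum
      -- The information I(X;Y,W) already exhausts the finite total, so cancelling it leaves zero
      -- divergence.
      have h0 : jointRDF Q.fst.fst D₁ D₂ Δ₁ Δ₂ + 0 = _ := (add_zero _).trans hsum
      exact ((ENNReal.add_right_inj htop).1 h0).symm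
    rw [hsnd] at hm₁ hm₂ hz
    rw [condIndepGiven_iff (by fun_prop) (by fun_prop) (by fun_prop) hm₁ hm₂]
    exact klDiv_eq_zero_iff.1 (hsnd ▸ hz)
  · rw [condLawEq_iff_mutualInfo_eq (by fun_prop) (by fun_prop) (by fun_prop) (heq ▸ htop),
      heq, heq']

end GrayWyner

/-! ### From the inequality to the Pangloss plane. -/

namespace GrayWyner

/-- If the `c n` are dominated by sequences converging to `a` and their sums are at least that of
`a`, then they converge to `a`. -/
lemma tendsto_of_le_of_sum_le {ι : Type*} [Fintype ι] {c r : ℕ → ι → ℝ≥0∞} {a : ι → ℝ≥0∞}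
    (ha : ∀ i, a i ≠ ∞) (hcr : ∀ n i, c n i ≤ r n i)
    (hr : ∀ i, Tendsto (fun n => r n i) atTop (𝓝 (a i))) (hsum : ∀ n, ∑ i, a i ≤ ∑ i, c n i)
    (i : ι) : Tendsto (fun n => c n i) atTop (𝓝 (a i)) := by
  classical
  have hfin : ∑ j ∈ Finset.univ.erase i, a j ≠ ∞ := ENNReal.sum_ne_top.2 fun j _ => ha j
  -- Lower bound for c n i: the total of a minus the upper bounds r n j of the other coordinates.
  have hlow : Tendsto (fun n => ∑ j, a j - ∑ j ∈ Finset.univ.erase i, r n j) atTop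
      (𝓝 (∑ j, a j - ∑ j ∈ Finset.univ.erase i, a j)) :=
    ENNReal.Tendsto.sub tendsto_const_nhds (tendsto_finsetSum _ fun j _ => hr j) (Or.inr hfin)
  rw [← Finset.add_sum_erase _ a (Finset.mem_univ i),
    ENNReal.add_sub_cancel_right hfin] at hlow
  refine tendsto_of_tendsto_of_tendsto_of_le_of_le hlow (hr i) (fun n => ?_) fun n => hcr n i
  rw [tsub_le_iff_right, Finset.add_sum_erase _ a (Finset.mem_univ i)]
  refine (hsum n).trans ?_
  rw [← Finset.add_sum_erase _ (c n) (Finset.mem_univ i)]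
  gcongr with j
  exact hcr n j

section Plane

variable {X₁ X₂ Y₁ Y₂ : Type*} [MeasurableSpace X₁] [MeasurableSpace X₂] [MeasurableSpace Y₁]
  [MeasurableSpace Y₂] [StandardBorelSpace Y₁] [Nonempty Y₁] [StandardBorelSpace Y₂] [Nonempty Y₂]
  {D₁ : X₁ → Y₁ → ℝ≥0∞} {D₂ : X₂ → Y₂ → ℝ≥0∞}

lemma sum_cornerPoint {W : Type*} [MeasurableSpace W] (ν : Measure ((X₁ × X₂) × W))
    [IsFiniteMeasure ν] (D₁ : X₁ → Y₁ → ℝ≥0∞) (D₂ : X₂ → Y₂ → ℝ≥0∞) (Δ₁ Δ₂ : ℝ≥0) :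
    ∑ i, cornerPoint ν D₁ D₂ Δ₁ Δ₂ i =
      mutualInfo ν + (condRDF (law₁ ν) D₁ Δ₁ + condRDF (law₂ ν) D₂ Δ₂) := by
  rw [Fin.sum_univ_three, add_assoc]
  rfl

lemma toReal_cornerPoint_mem_auxRegion {W : Type*} [MeasurableSpace W]
    {ν : Measure ((X₁ × X₂) × W)} [IsFiniteMeasure ν] {Δ₁ Δ₂ : ℝ≥0}
    (h : ∀ i, cornerPoint ν D₁ D₂ Δ₁ Δ₂ i ≠ ∞) :
    (fun i => (cornerPoint ν D₁ D₂ Δ₁ Δ₂ i).toReal) ∈ auxRegion ν D₁ D₂ Δ₁ Δ₂ :=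
  fun i => ⟨ENNReal.toReal_nonneg, (ENNReal.ofReal_toReal (h i)).ge⟩

lemma mem_region_of_mem_auxRegion {W : Type w} [MeasurableSpace W]
    {ν : Measure ((X₁ × X₂) × W)} [IsProbabilityMeasure ν] {Δ₁ Δ₂ : ℝ≥0} {R : Fin 3 → ℝ}
    (h : R ∈ auxRegion ν D₁ D₂ Δ₁ Δ₂) : R ∈ region.{w} ν.fst D₁ D₂ Δ₁ Δ₂ :=
  subset_closure ⟨W, _, ν, inferInstance, rfl, h⟩

lemma mem_panglossPlane_iff_of_mem_auxRegion (hD₁ : Measurable (Function.uncurry D₁))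
    (hD₂ : Measurable (Function.uncurry D₂)) {W : Type w} [MeasurableSpace W]
    {ν : Measure ((X₁ × X₂) × W)} [IsProbabilityMeasure ν] {Δ₁ Δ₂ : ℝ≥0} {R : Fin 3 → ℝ}
    (hR : R ∈ auxRegion ν D₁ D₂ Δ₁ Δ₂) :
    R ∈ panglossPlane.{w} ν.fst D₁ D₂ Δ₁ Δ₂ ↔
      (∀ i, ENNReal.ofReal (R i) = cornerPoint ν D₁ D₂ Δ₁ Δ₂ i) ∧
      mutualInfo ν + (condRDF (law₁ ν) D₁ Δ₁ + condRDF (law₂ ν) D₂ Δ₂) =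
        jointRDF ν.fst D₁ D₂ Δ₁ Δ₂ := by
  have hsum : ENNReal.ofReal (∑ i, R i) = ∑ i, ENNReal.ofReal (R i) :=
    ENNReal.ofReal_sum_of_nonneg fun i _ => (hR i).1
  rw [← sum_cornerPoint]
  constructor
  · rintro ⟨-, h⟩
    have hle := jointRDF_le_add ν hD₁ hD₂ Δ₁ Δ₂
    rw [← sum_cornerPoint, ← h, hsum] at hle
    -- The squeeze for constant sequences: domination in each coordinate and the reverse inequality
    -- of sums force equality.
    have heq : ∀ i, ENNReal.ofReal (R i) = cornerPoint ν D₁ D₂ Δ₁ Δ₂ i := fun i =>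
      tendsto_nhds_unique (tendsto_of_le_of_sum_le
        (c := fun _ => cornerPoint ν D₁ D₂ Δ₁ Δ₂) (r := fun _ j => ENNReal.ofReal (R j))
        (a := fun j => ENNReal.ofReal (R j)) (fun _ => ENNReal.ofReal_ne_top)
        (fun _ j => (hR j).2) (fun _ => tendsto_const_nhds) (fun _ => hle) i) tendsto_const_nhds
    refine ⟨heq, ?_⟩
    rw [← h, hsum]
    exact Finset.sum_congr rfl fun i _ => (heq i).symm
  · rintro ⟨heq, h⟩
    refine ⟨mem_region_of_mem_auxRegion hR, ?_⟩
    rw [← h, hsum]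
    exact Finset.sum_congr rfl fun i _ => heq i

lemma toReal_cornerPoint_mem_panglossPlane (hD₁ : Measurable (Function.uncurry D₁))
    (hD₂ : Measurable (Function.uncurry D₂)) {W : Type w} [MeasurableSpace W]
    {ν : Measure ((X₁ × X₂) × W)} [IsProbabilityMeasure ν] {Δ₁ Δ₂ : ℝ≥0}
    (h : mutualInfo ν + (condRDF (law₁ ν) D₁ Δ₁ + condRDF (law₂ ν) D₂ Δ₂) =
      jointRDF ν.fst D₁ D₂ Δ₁ Δ₂) (htop : jointRDF ν.fst D₁ D₂ Δ₁ Δ₂ ≠ ∞) :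
    (fun i => (cornerPoint ν D₁ D₂ Δ₁ Δ₂ i).toReal) ∈
      panglossPlane.{w} ν.fst D₁ D₂ Δ₁ Δ₂ := by
  have hfin : ∀ i, cornerPoint ν D₁ D₂ Δ₁ Δ₂ i ≠ ∞ := by
    rw [← h, ← sum_cornerPoint, ENNReal.sum_ne_top] at htop
    exact fun i => htop i (Finset.mem_univ i)
  rw [mem_panglossPlane_iff_of_mem_auxRegion hD₁ hD₂ (toReal_cornerPoint_mem_auxRegion hfin)]
  exact ⟨fun i => ENNReal.ofReal_toReal (hfin i), h⟩

/-- Triples approximating R dominate corner points whose sums are at least that of R, by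
`jointRDF_le_add`, so the corner points themselves converge to R. Conversely, finite corner points
belong to their own regions. -/
theorem mem_panglossPlane_iff_exists_tendsto (hD₁ : Measurable (Function.uncurry D₁))
    (hD₂ : Measurable (Function.uncurry D₂)) (P : Measure (X₁ × X₂)) (Δ₁ Δ₂ : ℝ≥0)
    (R : Fin 3 → ℝ) :
    R ∈ panglossPlane.{w} P D₁ D₂ Δ₁ Δ₂ ↔
      (∀ i, 0 ≤ R i) ∧ ENNReal.ofReal (∑ i, R i) = jointRDF P D₁ D₂ Δ₁ Δ₂ ∧
      ∃ (W : ℕ → Type w) (_ : ∀ n, MeasurableSpace (W n))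
        (ν : ∀ n, Measure ((X₁ × X₂) × W n)) (_ : ∀ n, IsProbabilityMeasure (ν n)),
        (∀ n, (ν n).fst = P) ∧
        ∀ i, Tendsto (fun n => cornerPoint (ν n) D₁ D₂ Δ₁ Δ₂ i) atTop
          (𝓝 (ENNReal.ofReal (R i))) := by
  constructor
  · rintro ⟨hR, hsum⟩
    obtain ⟨x, hx, hlim⟩ := mem_closure_iff_seq_limit.1 hR
    choose W mW ν hν hfst hmem using hx
    rw [tendsto_pi_nhds] at hlim
    have hpos : ∀ i, 0 ≤ R i := fun i => ge_of_tendsto' (hlim i) fun n => (hmem n i).1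
    refine ⟨hpos, hsum, W, mW, ν, hν, hfst, ?_⟩
    refine tendsto_of_le_of_sum_le (fun _ => ENNReal.ofReal_ne_top) (fun n i => (hmem n i).2)
      (fun i => ENNReal.tendsto_ofReal (hlim i)) fun n => ?_
    rw [← ENNReal.ofReal_sum_of_nonneg fun i _ => hpos i, hsum, sum_cornerPoint, ← hfst n]
    exact jointRDF_le_add (ν n) hD₁ hD₂ Δ₁ Δ₂
  · rintro ⟨hpos, hsum, W, mW, ν, hν, hfst, hlim⟩
    refine ⟨?_, hsum⟩
    have hreal : Tendsto (fun n i => (cornerPoint (ν n) D₁ D₂ Δ₁ Δ₂ i).toReal) atTop (𝓝 R) := by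
      refine tendsto_pi_nhds.2 fun i => ?_
      have := (ENNReal.tendsto_toReal ENNReal.ofReal_ne_top).comp (hlim i)
      rwa [ENNReal.toReal_ofReal (hpos i)] at this
    refine mem_closure_of_tendsto hreal ?_
    -- Finitely many corner points may have infinite coordinates, which `toReal` sends to 0,
    -- possibly outside the region; finiteness of the limits excludes this eventually.
    filter_upwards [eventually_all.2 fun i => (hlim i).eventually_ne ENNReal.ofReal_ne_top]
      with n hn
    exact ⟨W n, mW n, ν n, hν n, hfst n, toReal_cornerPoint_mem_auxRegion hn⟩

end Plane

end GrayWyner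

theorem theorem5
    {X₁ X₂ Y₁ Y₂ : Type*}
    [MeasurableSpace X₁] [MeasurableSpace X₂] [MeasurableSpace Y₁] [MeasurableSpace Y₂]
    [StandardBorelSpace Y₁] [Nonempty Y₁] [StandardBorelSpace Y₂] [Nonempty Y₂]
    (P : Measure (X₁ × X₂)) [IsProbabilityMeasure P]
    (D₁ : X₁ → Y₁ → ℝ≥0∞) (D₂ : X₂ → Y₂ → ℝ≥0∞)
    (hD₁ : Measurable (Function.uncurry D₁)) (hD₂ : Measurable (Function.uncurry D₂))
    (Δ₁ Δ₂ : ℝ≥0) :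
    -- For one auxiliary variable `W`: a triple of its region is on the plane iff it is the
    -- triple `(I(X₁,X₂;W), R_{X₁|W}(Δ₁), R_{X₂|W}(Δ₂))` and the latter has sum `R_{X₁,X₂}`.
    (∀ (W : Type w) [MeasurableSpace W] (ν : Measure ((X₁ × X₂) × W)) [IsProbabilityMeasure ν],
      ν.fst = P → ∀ R ∈ GrayWyner.auxRegion ν D₁ D₂ Δ₁ Δ₂,
        (R ∈ GrayWyner.panglossPlane.{w} P D₁ D₂ Δ₁ Δ₂ ↔
          (∀ i, ENNReal.ofReal (R i) = GrayWyner.cornerPoint ν D₁ D₂ Δ₁ Δ₂ i) ∧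
          GrayWyner.mutualInfo ν + (GrayWyner.condRDF (GrayWyner.law₁ ν) D₁ Δ₁ +
            GrayWyner.condRDF (GrayWyner.law₂ ν) D₂ Δ₂) = GrayWyner.jointRDF P D₁ D₂ Δ₁ Δ₂)) ∧
    -- The whole Pangloss plane (the region is a closure): limits of such triples.
    (∀ R : Fin 3 → ℝ, R ∈ GrayWyner.panglossPlane.{w} P D₁ D₂ Δ₁ Δ₂ ↔
      (∀ i, 0 ≤ R i) ∧
      ENNReal.ofReal (∑ i, R i) = GrayWyner.jointRDF P D₁ D₂ Δ₁ Δ₂ ∧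
      ∃ (W : ℕ → Type w) (_ : ∀ n, MeasurableSpace (W n))
        (ν : ∀ n, Measure ((X₁ × X₂) × W n)) (_ : ∀ n, IsProbabilityMeasure (ν n)),
        (∀ n, (ν n).fst = P) ∧
        ∀ i, Tendsto (fun n => GrayWyner.cornerPoint (ν n) D₁ D₂ Δ₁ Δ₂ i) atTop
          (𝓝 (ENNReal.ofReal (R i)))) ∧
    -- On the distortion region of `W` the equality holds, and the triple is on the plane.
    (∀ (W : Type w) [MeasurableSpace W] (ν : Measure ((X₁ × X₂) × W)) [IsProbabilityMeasure ν],
      ν.fst = P → (Δ₁, Δ₂) ∈ GrayWyner.distortionRegion ν D₁ D₂ →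
        GrayWyner.mutualInfo ν + (GrayWyner.condRDF (GrayWyner.law₁ ν) D₁ Δ₁ +
          GrayWyner.condRDF (GrayWyner.law₂ ν) D₂ Δ₂) = GrayWyner.jointRDF P D₁ D₂ Δ₁ Δ₂ ∧
        (GrayWyner.jointRDF P D₁ D₂ Δ₁ Δ₂ ≠ ∞ →
          (fun i => (GrayWyner.cornerPoint ν D₁ D₂ Δ₁ Δ₂ i).toReal) ∈
            GrayWyner.panglossPlane.{w} P D₁ D₂ Δ₁ Δ₂)) ∧
    -- Conversely, if the equality holds with finite value and the conditional rate distortion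
    -- functions have test channels, then `(Δ₁, Δ₂)` is in the distortion region of `W`.
    (∀ (W : Type w) [MeasurableSpace W] (ν : Measure ((X₁ × X₂) × W)) [IsProbabilityMeasure ν],
      ν.fst = P → GrayWyner.jointRDF P D₁ D₂ Δ₁ Δ₂ ≠ ∞ →
        GrayWyner.mutualInfo ν + (GrayWyner.condRDF (GrayWyner.law₁ ν) D₁ Δ₁ +
          GrayWyner.condRDF (GrayWyner.law₂ ν) D₂ Δ₂) = GrayWyner.jointRDF P D₁ D₂ Δ₁ Δ₂ →
        (∃ κ₁ : Kernel (X₁ × W) Y₁,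
          GrayWyner.IsCondTestChannel (GrayWyner.law₁ ν) D₁ Δ₁ κ₁) →
        (∃ κ₂ : Kernel (X₂ × W) Y₂,
          GrayWyner.IsCondTestChannel (GrayWyner.law₂ ν) D₂ Δ₂ κ₂) →
        (Δ₁, Δ₂) ∈ GrayWyner.distortionRegion ν D₁ D₂) := by
  refine ⟨?_, GrayWyner.mem_panglossPlane_iff_exists_tendsto hD₁ hD₂ P Δ₁ Δ₂, ?_, ?_⟩
  · rintro W _ ν _ rfl R hR
    exact GrayWyner.mem_panglossPlane_iff_of_mem_auxRegion hD₁ hD₂ hR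
  · rintro W _ ν _ rfl h
    have heq := GrayWyner.add_eq_jointRDF_of_mem_distortionRegion ν hD₁ hD₂ h
    exact ⟨heq, GrayWyner.toReal_cornerPoint_mem_panglossPlane hD₁ hD₂ heq⟩
  · rintro W _ ν _ rfl htop h ⟨κ₁, h₁⟩ ⟨κ₂, h₂⟩
    exact GrayWyner.mem_distortionRegion_of_add_eq_jointRDF ν hD₁ hD₂ htop h h₁ h₂
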